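/- Let $k$ be a field of characteristic zero. Let $A = k\langle x,y\rangle/(xy-yx-1)$ be the first Weyl algebra, $\mathbb{Z}$-graded by $\deg x = 1$ and $\deg y = -1$. Let $\mathbb{Z}_{\mathrm{fin}}$ be the group of finite subsets of $\mathbb{Z}$ under symmetric difference, and let $$C = k[x_n : n\in\mathbb{Z}]\big/\big(x_n^2+n = x_m^2+m \ \text{ for all } m,n\in\mathbb{Z}\big),$$ a $\mathbb{Z}_{\mathrm{fin}}$-graded $k$-algebra with $\deg x_n=\{n\}$. For an algebra $R$ graded by a group $\Gamma$, let $\mathrm{Gr}(R,\Gamma)$ denote the category of $\Gamma$-graded right $R$-modules and degree-preserving $R$-module homomorphisms. Then there is a ($k$-linear) equivalence of categories $$\mathrm{Gr}(A,\mathbb{Z}) \;\equiv\; \mathrm{Gr}(C,\mathbb{Z}_{\mathrm{fin}}).$$ -/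

import Mathlib

open CategoryTheory

universe u v w

namespace QuotientStackWeyl

/-! ### Gradings determined by the degrees of generators -/

section WordGrading

variable (k : Type*) {R ι Γ : Type*} [CommRing k] [Ring R] [Algebra k R]

/-- Given elements `g i` of a `k`-algebra `R` and a degree `d i` for each of them, the degree-`γ`
component is the `k`-span of all the words (finite products, in any order) in the `g i` whose total
degree is `γ`. When the `g i` generate `R`, this is the only possible grading of `R` in which
`g i` has degree `d i`. -/
def wordGrading [AddMonoid Γ] (g : ι → R) (d : ι → Γ) (γ : Γ) : Submodule k R :=
  Submodule.span k {a | ∃ l : List ι, (l.map g).prod = a ∧ (l.map d).sum = γ}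

theorem gen_mem_wordGrading [AddMonoid Γ] (g : ι → R) (d : ι → Γ) (i : ι) :
    g i ∈ wordGrading k g d (d i) :=
  Submodule.subset_span ⟨[i], by simp, by simp⟩

instance wordGrading_gradedMonoid [AddMonoid Γ] (g : ι → R) (d : ι → Γ) :
    SetLike.GradedMonoid (wordGrading k g d) where
  one_mem := Submodule.subset_span ⟨[], by simp, by simp⟩
  mul_mem := by
    intro a b x y hx hy
    have h : x * y ∈ wordGrading k g d a * wordGrading k g d b := Submodule.mul_mem_mul hx hy
    refine (?_ : wordGrading k g d a * wordGrading k g d b ≤ wordGrading k g d (a + b)) h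
    unfold wordGrading
    rw [Submodule.span_mul_span]
    refine Submodule.span_mono ?_
    rintro _ ⟨_, ⟨l, rfl, rfl⟩, _, ⟨m, rfl, rfl⟩, rfl⟩
    exact ⟨l ++ m, by simp, by simp⟩

/-- The word components do give a grading as soon as the `g i` generate `R` and there is an
algebra map to the external direct sum sending each `g i` to itself, placed in degree `d i`. -/
@[reducible] noncomputable def wordGradedAlgebra [AddMonoid Γ] [DecidableEq Γ]
    (g : ι → R) (d : ι → Γ)
    (hgen : Algebra.adjoin k (Set.range g) = ⊤)
    (f : R →ₐ[k] DirectSum Γ fun γ => wordGrading k g d γ)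
    (hf : ∀ i, f (g i) =
      DirectSum.of (fun γ => wordGrading k g d γ) (d i) ⟨g i, gen_mem_wordGrading k g d i⟩) :
    GradedAlgebra (wordGrading k g d) :=
  GradedAlgebra.ofAlgHom (wordGrading k g d) f
    (by
      refine AlgHom.ext_of_adjoin_eq_top hgen ?_
      rintro _ ⟨i, rfl⟩
      simp [hf])
    (by
      have key : ∀ l : List ι, ∀ h : (l.map g).prod ∈ wordGrading k g d (l.map d).sum,
          f (l.map g).prod =
            DirectSum.of (fun γ => wordGrading k g d γ) (l.map d).sum ⟨(l.map g).prod, h⟩ := by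
        intro l
        induction l with
        | nil =>
          intro h
          simp only [List.map_nil, List.prod_nil, map_one]
          rfl
        | cons i l ih =>
          intro h
          simp only [List.map_cons, List.prod_cons, map_mul]
          rw [hf, ih (Submodule.subset_span ⟨l, rfl, rfl⟩), DirectSum.of_mul_of]
          rfl
      rintro γ ⟨x, hx⟩
      have hx' := hx
      unfold wordGrading at hx'
      induction hx' using Submodule.span_induction with
      | mem x h =>
        obtain ⟨l, rfl, rfl⟩ := h
        exact key l hx
      | zero =>
        simp only [map_zero]
        exact (map_zero (DirectSum.of (fun γ => wordGrading k g d γ) γ)).symm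
      | add x y hx1 hy1 ihx ihy =>
        have h1 := ihx hx1
        have h2 := ihy hy1
        simp only at h1 h2 ⊢
        rw [map_add, h1, h2, ← map_add]
        rfl
      | smul c x hx1 ih =>
        have h1 := ih hx1
        simp only at h1 ⊢
        rw [map_smul, h1]
        exact ((DirectSum.lof k Γ (fun γ => wordGrading k g d γ) γ).map_smul c ⟨x, hx1⟩).symm)

end WordGrading

/-! ### The first Weyl algebra -/

section Weyl

variable (k : Type u) [Field k]

/-- The free generators of the free algebra `k⟨x, y⟩`. -/
inductive WeylGen : Type
  | x : WeylGen
  | y : WeylGen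

/-- The defining relation `xy = yx + 1`. -/
inductive WeylRel : FreeAlgebra k WeylGen → FreeAlgebra k WeylGen → Prop
  | comm : WeylRel
      (FreeAlgebra.ι k WeylGen.x * FreeAlgebra.ι k WeylGen.y)
      (FreeAlgebra.ι k WeylGen.y * FreeAlgebra.ι k WeylGen.x + 1)

/-- The first Weyl algebra `A = k⟨x, y⟩ / (xy - yx - 1)`. -/
abbrev WeylAlgebra : Type u := RingQuot (WeylRel k)

/-- The generators `x`, `y` of the Weyl algebra. -/
noncomputable def weylGen (i : WeylGen) : WeylAlgebra k :=
  RingQuot.mkAlgHom k (WeylRel k) (FreeAlgebra.ι k i)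

/-- The degrees `deg x = 1`, `deg y = -1`. -/
def weylDeg : WeylGen → ℤ
  | WeylGen.x => 1
  | WeylGen.y => -1

/-- The `ℤ`-grading of the Weyl algebra with `deg x = 1` and `deg y = -1`. -/
noncomputable def weylGrading : ℤ → Submodule k (WeylAlgebra k) :=
  wordGrading k (weylGen k) weylDeg

theorem weylGen_comm :
    weylGen k WeylGen.x * weylGen k WeylGen.y
      = weylGen k WeylGen.y * weylGen k WeylGen.x + 1 := by
  simpa [weylGen] using RingQuot.mkAlgHom_rel k (WeylRel.comm (k := k))

theorem weylGen_adjoin : Algebra.adjoin k (Set.range (weylGen k)) = ⊤ := by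
  have h : Set.range (weylGen k)
      = RingQuot.mkAlgHom k (WeylRel k) '' Set.range (FreeAlgebra.ι k) := by
    rw [← Set.range_comp]; rfl
  rw [h, ← AlgHom.map_adjoin, FreeAlgebra.adjoin_range_ι, Algebra.map_top,
    AlgHom.range_eq_top]
  exact RingQuot.mkAlgHom_surjective k (WeylRel k)

/-- A generator of the Weyl algebra, as an element of the external direct sum. -/
noncomputable def weylHomogeneousGen (i : WeylGen) :
    DirectSum ℤ fun n => wordGrading k (weylGen k) weylDeg n :=
  DirectSum.of (fun n => wordGrading k (weylGen k) weylDeg n) (weylDeg i)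
    ⟨weylGen k i, gen_mem_wordGrading k (weylGen k) weylDeg i⟩

theorem weylHomogeneousGen_comm :
    weylHomogeneousGen k WeylGen.x * weylHomogeneousGen k WeylGen.y
      = weylHomogeneousGen k WeylGen.y * weylHomogeneousGen k WeylGen.x + 1 := by
  unfold weylHomogeneousGen
  have h1 : weylGen k WeylGen.x * weylGen k WeylGen.y
      ∈ wordGrading k (weylGen k) weylDeg 0 :=
    Submodule.subset_span ⟨[WeylGen.x, WeylGen.y], by simp, by simp [weylDeg]⟩
  have h2 : weylGen k WeylGen.y * weylGen k WeylGen.x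
      ∈ wordGrading k (weylGen k) weylDeg 0 :=
    Submodule.subset_span ⟨[WeylGen.y, WeylGen.x], by simp, by simp [weylDeg]⟩
  have h3 : (1 : WeylAlgebra k) ∈ wordGrading k (weylGen k) weylDeg 0 :=
    SetLike.GradedOne.one_mem
  have e1 : ∀ (i j : WeylGen) (hd : weylDeg i + weylDeg j = 0)
      (h : weylGen k i * weylGen k j ∈ wordGrading k (weylGen k) weylDeg 0),
      (DirectSum.of (fun n => wordGrading k (weylGen k) weylDeg n) (weylDeg i)
          ⟨weylGen k i, gen_mem_wordGrading k (weylGen k) weylDeg i⟩) *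
        (DirectSum.of (fun n => wordGrading k (weylGen k) weylDeg n) (weylDeg j)
          ⟨weylGen k j, gen_mem_wordGrading k (weylGen k) weylDeg j⟩)
      = DirectSum.of (fun n => wordGrading k (weylGen k) weylDeg n) 0
          ⟨weylGen k i * weylGen k j, h⟩ := by
    intro i j hd h
    rw [DirectSum.of_mul_of]
    exact DirectSum.of_eq_of_gradedMonoid_eq (Sigma.subtype_ext hd rfl)
  have e2 : (1 : DirectSum ℤ fun n => wordGrading k (weylGen k) weylDeg n)
      = DirectSum.of (fun n => wordGrading k (weylGen k) weylDeg n) 0 ⟨1, h3⟩ := rfl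
  rw [e1 _ _ rfl h1, e1 _ _ rfl h2, e2, ← map_add]
  congr 1
  exact Subtype.ext (weylGen_comm k)

noncomputable instance weylGradedAlgebra : GradedAlgebra (weylGrading k) :=
  wordGradedAlgebra k (weylGen k) weylDeg (weylGen_adjoin k)
    (RingQuot.liftAlgHom k ⟨FreeAlgebra.lift k (weylHomogeneousGen k), by
      rintro _ _ ⟨⟩
      simpa using weylHomogeneousGen_comm k⟩)
    (by
      intro i
      simp [weylGen, weylHomogeneousGen])

end Weyl

/-! ### The commutative ring `C` -/

section RingC

variable (k : Type u) [Field k]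

/-- The group `ℤ_fin` of finite subsets of `ℤ` under symmetric difference (written additively). -/
abbrev ZFin : Type := AsBoolRing (Finset ℤ)

instance : DecidableEq ZFin := inferInstanceAs (DecidableEq (Finset ℤ))

/-- The ideal of `k[x_n : n ∈ ℤ]` generated by the elements `(x_n² + n) - (x_m² + m)`. -/
noncomputable def relationIdeal : Ideal (MvPolynomial ℤ k) :=
  Ideal.span (Set.range fun p : ℤ × ℤ =>
    (MvPolynomial.X p.1 ^ 2 + (p.1 : MvPolynomial ℤ k))
      - (MvPolynomial.X p.2 ^ 2 + (p.2 : MvPolynomial ℤ k)))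

/-- The ring `C = k[x_n : n ∈ ℤ] / (x_n² + n = x_m² + m)`. -/
abbrev RingC : Type u := MvPolynomial ℤ k ⧸ relationIdeal k

/-- The generators `x_n` of `C`. -/
noncomputable def genC (n : ℤ) : RingC k := Ideal.Quotient.mkₐ k (relationIdeal k) (MvPolynomial.X n)

/-- The degree `deg x_n = {n}`. -/
def degC (n : ℤ) : ZFin := toBoolRing ({n} : Finset ℤ)

/-- The `ℤ_fin`-grading of `C` with `deg x_n = {n}`. -/
noncomputable def gradingC : ZFin → Submodule k (RingC k) :=
  wordGrading k (genC k) degC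

theorem genC_rel (n m : ℤ) : genC k n * genC k n + (n : RingC k) = genC k m * genC k m + m := by
  have h : ((MvPolynomial.X n ^ 2 + (n : MvPolynomial ℤ k))
      - (MvPolynomial.X m ^ 2 + (m : MvPolynomial ℤ k))) ∈ relationIdeal k :=
    Ideal.subset_span ⟨(n, m), rfl⟩
  have h2 := Ideal.Quotient.eq_zero_iff_mem.2 h
  rw [map_sub, sub_eq_zero] at h2
  simpa [genC, pow_two] using h2

theorem genC_adjoin : Algebra.adjoin k (Set.range (genC k)) = ⊤ := by
  have h : Set.range (genC k)
      = Ideal.Quotient.mkₐ k (relationIdeal k) '' Set.range MvPolynomial.X := by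
    rw [← Set.range_comp]; rfl
  rw [h, ← AlgHom.map_adjoin, MvPolynomial.adjoin_range_X, Algebra.map_top,
    AlgHom.range_eq_top]
  exact Ideal.Quotient.mkₐ_surjective k (relationIdeal k)

/-- A generator of `C`, as an element of the external direct sum. -/
noncomputable def homogeneousGenC (n : ℤ) :
    DirectSum ZFin fun I => wordGrading k (genC k) degC I :=
  DirectSum.of (fun I => wordGrading k (genC k) degC I) (degC n)
    ⟨genC k n, gen_mem_wordGrading k (genC k) degC n⟩

theorem degC_add_self (n : ℤ) : degC n + degC n = 0 :=
  symmDiff_self ({n} : Finset ℤ)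

theorem of_intC (n : ℤ) (h : (n : RingC k) ∈ wordGrading k (genC k) degC 0) :
    (n : DirectSum ZFin fun I => wordGrading k (genC k) degC I)
      = DirectSum.of (fun I => wordGrading k (genC k) degC I) 0 ⟨n, h⟩ := rfl

theorem homogeneousGenC_rel (n m : ℤ) :
    homogeneousGenC k n * homogeneousGenC k n + n
      = homogeneousGenC k m * homogeneousGenC k m + m := by
  have hint : ∀ j : ℤ, (j : RingC k) ∈ wordGrading k (genC k) degC 0 := fun j => by
    rw [← zsmul_one]
    exact zsmul_mem (SetLike.GradedOne.one_mem (A := wordGrading k (genC k) degC)) j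
  have hsq : ∀ j : ℤ, genC k j * genC k j ∈ wordGrading k (genC k) degC 0 := fun j => by
    rw [← degC_add_self j]
    exact SetLike.mul_mem_graded (gen_mem_wordGrading k _ _ j) (gen_mem_wordGrading k _ _ j)
  have hmul : ∀ j : ℤ, homogeneousGenC k j * homogeneousGenC k j
      = DirectSum.of (fun I => wordGrading k (genC k) degC I) 0 ⟨genC k j * genC k j, hsq j⟩ := by
    intro j
    unfold homogeneousGenC
    rw [DirectSum.of_mul_of]
    exact DirectSum.of_eq_of_gradedMonoid_eq (Sigma.subtype_ext (degC_add_self j) rfl)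
  rw [hmul, hmul, of_intC k n (hint n), of_intC k m (hint m), ← map_add, ← map_add]
  congr 1
  exact Subtype.ext (genC_rel k n m)

/-- The algebra map from the polynomial ring to the external direct sum with `x_n ↦ x_n`. -/
noncomputable def polyToDirectSum :
    MvPolynomial ℤ k →ₐ[k] DirectSum ZFin fun I => wordGrading k (genC k) degC I :=
  MvPolynomial.aeval (homogeneousGenC k)

theorem polyToDirectSum_X (n : ℤ) :
    polyToDirectSum k (MvPolynomial.X n) = homogeneousGenC k n :=
  MvPolynomial.aeval_X (homogeneousGenC k) n

noncomputable instance gradedAlgebraC : GradedAlgebra (gradingC k) :=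
  wordGradedAlgebra k (genC k) degC (genC_adjoin k)
    (Ideal.Quotient.liftₐ (relationIdeal k) (polyToDirectSum k) (by
      intro a ha
      refine (Ideal.span_le (I := RingHom.ker (polyToDirectSum k))).2 ?_ ha
      rintro _ ⟨⟨n, m⟩, rfl⟩
      have h := homogeneousGenC_rel k n m
      simp only [SetLike.mem_coe, RingHom.mem_ker, map_sub, map_add, map_mul,
        polyToDirectSum_X, map_intCast, pow_two]
      rw [h, sub_self]))
    (fun n => polyToDirectSum_X k n)

end RingC

/-! ### Categories of graded right modules -/

section GradedModules

variable {k : Type*} {R : Type*} {Γ : Type*} [CommRing k] [Ring R] [Algebra k R]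
  [AddGroup Γ] [DecidableEq Γ]

/-- A `Γ`-graded right module over the `Γ`-graded `k`-algebra `(R, 𝒜)`: a right `R`-module `M`
(that is, a left module over the opposite ring) that is the internal direct sum of additive
subgroups `M_γ` with `M_γ R_δ ⊆ M_{γ + δ}`. -/
structure GrMod (𝒜 : Γ → Submodule k R) [GradedAlgebra 𝒜] where
  /-- The underlying type. -/
  carrier : Type w
  [addCommGroup : AddCommGroup carrier]
  [module : Module Rᵐᵒᵖ carrier]
  /-- The homogeneous components. -/
  component : Γ → AddSubgroup carrier
  isInternal : DirectSum.IsInternal component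
  op_smul_mem : ∀ {γ δ : Γ} {m : carrier} {r : R}, m ∈ component γ → r ∈ 𝒜 δ →
    MulOpposite.op r • m ∈ component (γ + δ)

namespace GrMod

variable {𝒜 : Γ → Submodule k R} [GradedAlgebra 𝒜]

attribute [instance] GrMod.addCommGroup GrMod.module

/-- The `k`-module structure of a graded right `R`-module, given by `k → R`. -/
instance baseModule (M : GrMod.{w} 𝒜) : Module k M.carrier :=
  Module.compHom M.carrier (algebraMap k Rᵐᵒᵖ)

theorem base_smul_def (M : GrMod.{w} 𝒜) (c : k) (m : M.carrier) :
    c • m = MulOpposite.op (algebraMap k R c) • m := rfl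

instance (M : GrMod.{w} 𝒜) : IsScalarTower k Rᵐᵒᵖ M.carrier where
  smul_assoc c r m := by
    rw [Algebra.smul_def, mul_smul]
    rfl

instance (M : GrMod.{w} 𝒜) : SMulCommClass Rᵐᵒᵖ k M.carrier :=
  IsScalarTower.to_smulCommClass'

/-- The degree-preserving `R`-module homomorphisms from `M` to `N`, a `k`-submodule of all the
`R`-module homomorphisms. -/
def homs (M N : GrMod.{w} 𝒜) : Submodule k (M.carrier →ₗ[Rᵐᵒᵖ] N.carrier) where
  carrier := {f | ∀ (γ : Γ) (m : M.carrier), m ∈ M.component γ → f m ∈ N.component γ}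
  zero_mem' := fun γ _ _ => (N.component γ).zero_mem
  add_mem' := fun hf hg γ m hm => (N.component γ).add_mem (hf γ m hm) (hg γ m hm)
  smul_mem' := fun c f hf γ m hm => by
    have h := N.op_smul_mem (hf γ m hm) (algebraMap_mem_zero c)
    rw [add_zero] at h
    exact h
where
  /-- Scalars are homogeneous of degree zero. -/
  algebraMap_mem_zero (c : k) : algebraMap k R c ∈ 𝒜 0 :=
    SetLike.algebraMap_mem_graded 𝒜 c

/-- The category `Gr(R, Γ)` of graded right `R`-modules and degree-preserving homomorphisms. -/
instance category : Category (GrMod.{w} 𝒜) where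
  Hom M N := homs M N
  id M := ⟨LinearMap.id, fun _ _ hm => hm⟩
  comp f g := ⟨g.1.comp f.1, fun γ _ hm => g.2 γ _ (f.2 γ _ hm)⟩

instance preadditive : Preadditive (GrMod.{w} 𝒜) where
  homGroup M N := inferInstanceAs (AddCommGroup (homs M N))
  add_comp _ _ _ f f' g := Subtype.ext (LinearMap.comp_add f.1 f'.1 g.1)
  comp_add _ _ _ f g g' := Subtype.ext (LinearMap.add_comp f.1 g'.1 g.1)

instance linear : Linear k (GrMod.{w} 𝒜) where
  homModule M N := inferInstanceAs (Module k (homs M N))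
  smul_comp _ _ _ c f g := Subtype.ext (LinearMap.ext fun m =>
    g.1.map_smul (MulOpposite.op (algebraMap k R c)) (f.1 m))
  comp_smul _ _ _ _ _ _ := rfl

end GrMod

end GradedModules

end QuotientStackWeyl

/-!
Write `x`, `y` for the generators of the Weyl algebra `A`. On a graded right `A`-module `M` the
operator `z = xy - n` in degree `n` commutes with `x` and `y`, so `M` is a chain of `k[z]`-modules
`M_n` in which `x : M_n → M_{n+1}` and `y : M_{n+1} → M_n` compose, both ways round, to `z + n`.
A graded `C`-module is a family of `k[z]`-modules `N_I`, indexed by the finite sets `I` of integers,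
with commuting maps `x_i : N_I → N_{I ∆ {i}}` that compose to `x_i ^ 2 = z - i`. Give the step
between the degrees `n` and `n + 1` the label `-n`, and let `steps n` be the set of labels between
`0` and `n`. Then `M` is a module over the full subcategory, on the objects `steps n`, of the
category with objects `I` and morphisms `I → J` the component of `C` of degree `I ∆ J`. The theorem
is the Morita equivalence between this subcategory and the whole category.

The functor from `Gr(A, ℤ)` to `Gr(C, ℤ_fin)` is the right Kan extension, `GrMod.kan`. As the
morphisms from `I` to `steps n` form a free `k[z]`-module generated by the monomial of
`sep I n = I ∆ steps n`, its value at `I` is the space of families `t n ∈ M_n` (`GrMod.compatible`)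
in which neighbours determine each other through `x` or through `y`, according to whether the label
of the step between them lies in `sep I n`; the generator `x_i` of `C` multiplies `t n` by `1` or by
`z - i` (`GrMod.crossing`).

The functor is fully faithful because the value at `steps n` is `M_n` itself
(`GrMod.orbitFamily_eval`), and because crossing the labels in `sep I n` one at a time moves a
family at `I` to one at `steps n` with the same element in degree `n` (`GrMod.onFamilies_apply`).

It is essentially surjective because a graded `C`-module `N` is recovered from its restriction
`GrMod.restrict` to the objects `steps n`: an element of `N_I` is sent to the family of its
multiples by the monomials of the sets `sep I n`. For `p` far below and `q` far above `0`, the sets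
`sep I p` and `sep I q` are disjoint (`exists_disjoint_sep`), so in characteristic zero the squares
of their monomials are products of pairwise coprime factors `z - i` and generate the unit ideal of
`k[z]` (`exists_bezout_monomialC`). This Bézout relation shows that an element is determined by
its multiples (`GrMod.eq_zero_of_smul_monomialC`) and that every compatible family arises in this
way (`GrMod.exists_smul_monomialC_eq`).
-/

namespace QuotientStackWeyl

open MulOpposite DirectSum
open scoped RightActions symmDiff

/-! ### Morphisms of graded modules from their homogeneous components -/

namespace GrMod

section Generic

variable {k : Type*} {R : Type*} {Γ : Type*} [CommRing k] [Ring R] [Algebra k R]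
  [AddGroup Γ] [DecidableEq Γ] {𝒜 : Γ → Submodule k R} [GradedAlgebra 𝒜]

theorem addHom_ext (M : GrMod.{w} 𝒜) {B : Type*} [AddCommMonoid B] {f g : M.carrier →+ B}
    (h : ∀ γ, ∀ m ∈ M.component γ, f m = g m) : f = g := by
  have key : f.comp (DirectSum.coeAddMonoidHom M.component)
      = g.comp (DirectSum.coeAddMonoidHom M.component) := by
    refine DirectSum.addHom_ext fun γ m => ?_
    simpa using h γ m m.2
  ext m
  obtain ⟨x, rfl⟩ := M.isInternal.2 m
  exact DFunLike.congr_fun key x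

theorem hom_ext {M N : GrMod.{w} 𝒜} {f g : M ⟶ N}
    (h : ∀ γ, ∀ m ∈ M.component γ, f.1 m = g.1 m) : f = g :=
  Subtype.ext (LinearMap.toAddMonoidHom_injective
    (M.addHom_ext (f := f.1.toAddMonoidHom) (g := g.1.toAddMonoidHom) h))

/-- The additive map on a graded module with prescribed restrictions to the homogeneous
components. -/
noncomputable def glue (M : GrMod.{w} 𝒜) {B : Type*} [AddCommMonoid B]
    (φ : ∀ γ, M.component γ →+ B) : M.carrier →+ B :=
  (DirectSum.toAddMonoid φ).comp
    (AddEquiv.ofBijective (DirectSum.coeAddMonoidHom M.component) M.isInternal).symm.toAddMonoidHom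

theorem glue_apply (M : GrMod.{w} 𝒜) {B : Type*} [AddCommMonoid B]
    (φ : ∀ γ, M.component γ →+ B) {γ : Γ} {m : M.carrier} (hm : m ∈ M.component γ) :
    M.glue φ m = φ γ ⟨m, hm⟩ := by
  have h : (AddEquiv.ofBijective (DirectSum.coeAddMonoidHom M.component) M.isInternal).symm m
      = DirectSum.of (fun γ => M.component γ) γ ⟨m, hm⟩ := by
    rw [AddEquiv.symm_apply_eq]
    exact (DirectSum.coeAddMonoidHom_of M.component γ ⟨m, hm⟩).symm
  simp only [glue, AddMonoidHom.comp_apply, AddEquiv.toAddMonoidHom_eq_coe, AddMonoidHom.coe_coe]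
  rw [h, DirectSum.toAddMonoid_of]

/-- An additive map between graded modules that preserves degrees is a morphism as soon as it
commutes, on homogeneous elements, with the scalars of `k` and with generators of the algebra. -/
def homOfAddHom {ι : Type*} {g : ι → R} (hgen : Algebra.adjoin k (Set.range g) = ⊤)
    {M N : GrMod.{w} 𝒜} (f : M.carrier →+ N.carrier)
    (hdeg : ∀ γ, ∀ m ∈ M.component γ, f m ∈ N.component γ)
    (hs : ∀ c : k, ∀ γ, ∀ m ∈ M.component γ,
      f (m <• algebraMap k R c) = f m <• algebraMap k R c)
    (hg : ∀ i, ∀ γ, ∀ m ∈ M.component γ, f (m <• g i) = f m <• g i) : M ⟶ N :=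
  ⟨{ f with
      map_smul' := by
        have key : ∀ r : R, (∀ γ, ∀ m ∈ M.component γ, f (m <• r) = f m <• r) →
            ∀ m, f (m <• r) = f m <• r := by
          intro r h m
          exact DFunLike.congr_fun (M.addHom_ext
            (f := f.comp (DistribSMul.toAddMonoidHom M.carrier (op r)))
            (g := (DistribSMul.toAddMonoidHom N.carrier (op r)).comp f) h) m
        intro r
        obtain ⟨r, rfl⟩ := op_surjective r
        have hr : r ∈ Algebra.adjoin k (Set.range g) := hgen ▸ Algebra.mem_top
        change ∀ m, f (m <• r) = f m <• r
        induction hr using Algebra.adjoin_induction with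
        | mem r hr =>
          obtain ⟨i, rfl⟩ := hr
          exact key _ (hg i)
        | algebraMap c => exact key _ (hs c)
        | add r s _ _ hr hs =>
            intro m
            rw [MulOpposite.op_add, add_smul, map_add, hr, hs, add_smul]
        | mul r s _ _ hr hs =>
            intro m
            rw [op_mul, mul_smul, hs, hr, mul_smul] }, hdeg⟩

/-- A morphism of graded modules that is bijective in every degree is an isomorphism. -/
theorem nonempty_iso_of_bijOn {M N : GrMod.{w} 𝒜} (f : M ⟶ N)
    (h : ∀ γ, Set.BijOn f.1 (M.component γ) (N.component γ)) : Nonempty (M ≅ N) := by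
  let e : ∀ γ, M.component γ ≃+ N.component γ := fun γ =>
    AddEquiv.ofBijective
      ((f.1.toAddMonoidHom.comp (M.component γ).subtype).codRestrict (N.component γ)
        fun m => f.2 γ _ m.2)
      ⟨fun a b hab => Subtype.ext ((h γ).injOn a.2 b.2 (congrArg Subtype.val hab)), fun b => by
        obtain ⟨a, ha, hab⟩ := (h γ).surjOn b.2
        exact ⟨⟨a, ha⟩, Subtype.ext hab⟩⟩
  let ψ : N.carrier →+ M.carrier := N.glue fun γ =>
    (M.component γ).subtype.comp (e γ).symm.toAddMonoidHom
  have hψ : ∀ γ, ∀ m ∈ M.component γ, ψ (f.1 m) = m := by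
    intro γ m hm
    refine (N.glue_apply _ (f.2 γ m hm)).trans ?_
    exact congrArg Subtype.val ((e γ).symm_apply_apply ⟨m, hm⟩)
  have h1 : ∀ m, ψ (f.1 m) = m := fun m =>
    DFunLike.congr_fun (M.addHom_ext (f := ψ.comp f.1.toAddMonoidHom)
      (g := AddMonoidHom.id _) hψ) m
  have h2 : ∀ n, f.1 (ψ n) = n := fun n =>
    DFunLike.congr_fun (N.addHom_ext (f := f.1.toAddMonoidHom.comp ψ)
      (g := AddMonoidHom.id _) (fun γ n hn => by
        obtain ⟨m, hm, rfl⟩ := (h γ).surjOn hn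
        exact congrArg f.1 (h1 m))) n
  let E : M.carrier ≃ₗ[Rᵐᵒᵖ] N.carrier :=
    LinearEquiv.ofBijective f.1 ⟨Function.LeftInverse.injective h1, fun n => ⟨_, h2 n⟩⟩
  have hE : ∀ n, E.symm n = ψ n := fun n => by
    rw [LinearEquiv.symm_apply_eq]
    exact (h2 n).symm
  let finv : N ⟶ M := ⟨E.symm.toLinearMap, fun γ n hn => by
    obtain ⟨m, hm, rfl⟩ := (h γ).surjOn hn
    change E.symm _ ∈ _
    rwa [hE, h1]⟩
  exact ⟨⟨f, finv, Subtype.ext (LinearMap.ext fun m => (hE _).trans (h1 m)),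
    Subtype.ext (LinearMap.ext fun n => (congrArg f.1 (hE n)).trans (h2 n))⟩⟩

theorem base_smul_mem {M : GrMod.{w} 𝒜} {γ : Γ} {m : M.carrier} (c : k)
    (hm : m ∈ M.component γ) : c • m ∈ M.component γ := by
  have h := M.op_smul_mem hm (SetLike.algebraMap_mem_graded 𝒜 c)
  rwa [add_zero] at h

end Generic

/-! ### Graded modules from families of components -/

section OfFamily

variable {k : Type*} {R : Type*} {Γ : Type} [CommRing k] [Ring R] [Algebra k R]
  [AddGroup Γ] [DecidableEq Γ] {𝒜 : Γ → Submodule k R} [GradedAlgebra 𝒜]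
  {V : Type w} [AddCommGroup V] [Module k V]

omit [AddGroup Γ] in
theorem of_eq_of {P : Γ → Submodule k V} {γ δ : Γ} (h : γ = δ) {m : P γ} {m' : P δ}
    (hm : (m : V) = m') :
    DirectSum.of (fun γ => P γ) γ m = DirectSum.of (fun γ => P γ) δ m' := by
  subst h
  rw [Subtype.ext hm]

/-- The endomorphism of `⨁ γ, P γ` that shifts degrees by `δ`, given its components. -/
noncomputable def shiftEnd {P : Γ → Submodule k V} {δ : Γ} (T : ∀ γ, P γ →ₗ[k] P (γ + δ)) :
    Module.End k (⨁ γ, P γ) :=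
  DirectSum.toModule k Γ _ fun γ => (DirectSum.lof k Γ (fun γ => P γ) (γ + δ)).comp (T γ)

@[simp] theorem shiftEnd_of {P : Γ → Submodule k V} {δ : Γ} (T : ∀ γ, P γ →ₗ[k] P (γ + δ))
    (γ : Γ) (m : P γ) :
    shiftEnd T (DirectSum.of (fun γ => P γ) γ m) = DirectSum.of (fun γ => P γ) (γ + δ) (T γ m) :=
  DirectSum.toModule_lof k (M := fun γ => P γ)
    (φ := fun γ => (DirectSum.lof k Γ (fun γ => P γ) (γ + δ)).comp (T γ)) γ m

/-- The graded module with underlying space `⨁ γ, P γ` on which `R` acts through `ρ`, where every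
generator `g i` of degree `d i` acts by components `P γ → P (γ + d i)`. -/
noncomputable def ofFamily {ι : Type*} {g : ι → R} {d : ι → Γ} (h𝒜 : 𝒜 = wordGrading k g d)
    (P : Γ → Submodule k V) (ρ : R →ₐ[k] (Module.End k (⨁ γ, P γ))ᵐᵒᵖ)
    (T : ∀ i γ, P γ →ₗ[k] P (γ + d i)) (hρ : ∀ i, ρ (g i) = op (shiftEnd (T i))) :
    GrMod.{w} 𝒜 :=
  letI : Module Rᵐᵒᵖ (⨁ γ, P γ) :=
    Module.compHom _ ((RingEquiv.opOp _).symm.toRingHom.comp (RingHom.op ρ.toRingHom))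
  { carrier := ⨁ γ, P γ
    component := fun γ => (DirectSum.of (fun γ => P γ) γ).range
    isInternal := by
      let F : (⨁ γ, P γ) →+ ⨁ γ, (DirectSum.of (fun γ => P γ) γ).range :=
        DirectSum.map fun γ => (DirectSum.of (fun γ => P γ) γ).rangeRestrict
      let G := DirectSum.coeAddMonoidHom fun γ => (DirectSum.of (fun γ => P γ) γ).range
      have h1 : G.comp F = AddMonoidHom.id _ := by
        refine DirectSum.addHom_ext fun γ m => ?_
        simp [F, G]
      have h2 : F.comp G = AddMonoidHom.id _ := by
        refine DirectSum.addHom_ext ?_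
        rintro γ ⟨_, m, rfl⟩
        simp only [AddMonoidHom.comp_apply, F, G, DirectSum.coeAddMonoidHom_of, DirectSum.map_of]
        rfl
      exact ⟨Function.LeftInverse.injective (g := F) (DFunLike.congr_fun h2),
        Function.RightInverse.surjective (g := F) (DFunLike.congr_fun h1)⟩
    op_smul_mem := by
      rintro γ δ _ r ⟨m, rfl⟩ hr
      change (ρ r).unop _ ∈ _
      rw [h𝒜] at hr
      unfold wordGrading at hr
      induction hr using Submodule.span_induction with
      | mem r hr =>
        obtain ⟨l, rfl, rfl⟩ := hr
        induction l generalizing γ with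
        | nil =>
          simp only [List.map_nil, List.prod_nil, map_one, unop_one, Module.End.one_apply]
          exact ⟨⟨m, by simp⟩, of_eq_of (P := P) (by simp) rfl⟩
        | cons i l ih =>
          obtain ⟨m', hm'⟩ := ih (T i γ m)
          simp only [List.map_cons, List.prod_cons, map_mul, hρ, unop_mul, unop_op,
            Module.End.mul_apply, shiftEnd_of]
          rw [← hm']
          exact ⟨⟨m', by simpa [add_assoc] using m'.2⟩, of_eq_of (P := P) (by simp [add_assoc]) rfl⟩
      | zero => simp
      | add r s _ _ hr hs =>
        rw [map_add, MulOpposite.unop_add, LinearMap.add_apply]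
        exact add_mem hr hs
      | smul c r _ hr =>
        rw [map_smul, unop_smul, LinearMap.smul_apply]
        obtain ⟨m', hm'⟩ := hr
        rw [← hm']
        exact ⟨c • m', (DirectSum.lof k Γ (fun γ => P γ) (γ + δ)).map_smul c m'⟩ }

section

variable {ι : Type*} {g : ι → R} {d : ι → Γ} (h𝒜 : 𝒜 = wordGrading k g d)
    (P : Γ → Submodule k V) (ρ : R →ₐ[k] (Module.End k (⨁ γ, P γ))ᵐᵒᵖ)
    (T : ∀ i γ, P γ →ₗ[k] P (γ + d i)) (hρ : ∀ i, ρ (g i) = op (shiftEnd (T i)))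

/-- A homogeneous element of `ofFamily`. -/
noncomputable def single (γ : Γ) : P γ →+ (ofFamily h𝒜 P ρ T hρ).carrier :=
  DirectSum.of (fun γ => P γ) γ

theorem single_mem (γ : Γ) (m : P γ) :
    single h𝒜 P ρ T hρ γ m ∈ (ofFamily h𝒜 P ρ T hρ).component γ :=
  ⟨m, rfl⟩

theorem exists_single {γ : Γ} {x : (ofFamily h𝒜 P ρ T hρ).carrier}
    (hx : x ∈ (ofFamily h𝒜 P ρ T hρ).component γ) : ∃ m, single h𝒜 P ρ T hρ γ m = x :=
  hx

theorem single_injective (γ : Γ) : Function.Injective (single h𝒜 P ρ T hρ γ) :=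
  DirectSum.of_injective γ

theorem single_eq_single {γ δ : Γ} (h : γ = δ) {m : P γ} {m' : P δ} (hm : (m : V) = m') :
    single h𝒜 P ρ T hρ γ m = single h𝒜 P ρ T hρ δ m' :=
  of_eq_of h hm

theorem single_smul_gen (i : ι) (γ : Γ) (m : P γ) :
    single h𝒜 P ρ T hρ γ m <• g i = single h𝒜 P ρ T hρ (γ + d i) (T i γ m) := by
  change (ρ (g i)).unop (DirectSum.of (fun γ => P γ) γ m) = _
  rw [hρ]
  exact shiftEnd_of _ _ _

theorem single_smul_algebraMap (c : k) (γ : Γ) (m : P γ) :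
    single h𝒜 P ρ T hρ γ m <• algebraMap k R c = single h𝒜 P ρ T hρ γ (c • m) := by
  change (ρ (algebraMap k R c)).unop (DirectSum.of (fun γ => P γ) γ m) = _
  rw [AlgHom.commutes]
  exact ((DirectSum.lof k Γ (fun γ => P γ) γ).map_smul c m).symm

end

end OfFamily

end GrMod

/-! ### Actions of the two algebras from operators -/

section Actions

variable {k : Type u} [Field k] {W : Type*} [AddCommGroup W] [Module k W]

/-- The generators of the Weyl algebra placed in the opposite of the algebra of operators. -/
def weylOperator (X Y : Module.End k W) : WeylGen → (Module.End k W)ᵐᵒᵖ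
  | WeylGen.x => op X
  | WeylGen.y => op Y

/-- The right action of the Weyl algebra given by the operators of `x` and `y`. -/
noncomputable def weylAction (X Y : Module.End k W) (h : Y * X = X * Y + 1) :
    WeylAlgebra k →ₐ[k] (Module.End k W)ᵐᵒᵖ :=
  RingQuot.liftAlgHom k ⟨FreeAlgebra.lift k (weylOperator X Y), by
    rintro _ _ ⟨⟩
    simp only [map_mul, map_add, map_one, FreeAlgebra.lift_ι_apply, weylOperator]
    rw [← op_mul, ← op_mul, h, MulOpposite.op_add, op_one]⟩

theorem weylAction_gen (X Y : Module.End k W) (h : Y * X = X * Y + 1) (i : WeylGen) :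
    weylAction X Y h (weylGen k i) = weylOperator X Y i := by
  simp [weylAction, weylGen]

open scoped IsMulCommutative in
/-- An action of `C` is a family of commuting operators `X n` for which `X n ^ 2 + n` is
independent of `n`. -/
theorem exists_ringC_action (X : ℤ → Module.End k W) (hcomm : ∀ i j, X i * X j = X j * X i)
    (hrel : ∀ i j, X i * X i + algebraMap k (Module.End k W) i
      = X j * X j + algebraMap k (Module.End k W) j) :
    ∃ ρ : RingC k →ₐ[k] (Module.End k W)ᵐᵒᵖ, ∀ i, ρ (genC k i) = op (X i) := by
  have : IsMulCommutative (Algebra.adjoin k (Set.range X)) :=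
    Algebra.isMulCommutative_adjoin k (by
      rintro _ ⟨i, rfl⟩ _ ⟨j, rfl⟩
      exact hcomm i j)
  let f : MvPolynomial ℤ k →ₐ[k] Algebra.adjoin k (Set.range X) :=
    MvPolynomial.aeval fun i => ⟨X i, Algebra.subset_adjoin ⟨i, rfl⟩⟩
  have hf : ∀ i, f (MvPolynomial.X i) = ⟨X i, Algebra.subset_adjoin ⟨i, rfl⟩⟩ :=
    fun i => MvPolynomial.aeval_X _ i
  let φ : RingC k →ₐ[k] Algebra.adjoin k (Set.range X) :=
    Ideal.Quotient.liftₐ (relationIdeal k) f (by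
      intro a ha
      refine (Ideal.span_le (I := RingHom.ker f)).2 ?_ ha
      rintro _ ⟨⟨n, m⟩, rfl⟩
      simp only [SetLike.mem_coe, RingHom.mem_ker, map_sub, map_add, map_pow, map_intCast, hf]
      rw [sub_eq_zero, pow_two, pow_two]
      have h := hrel n m
      simp only [map_intCast] at h
      exact Subtype.ext h)
  refine ⟨((Algebra.adjoin k (Set.range X)).val.comp φ).toOpposite fun a b => ?_, fun i => ?_⟩
  · exact (Commute.all (φ a) (φ b)).map (Algebra.adjoin k (Set.range X)).val
  · change op (φ (genC k i) : Module.End k W) = _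
    exact congrArg (fun a : Algebra.adjoin k (Set.range X) => op (a : Module.End k W)) (hf i)

/-- The case of `exists_ringC_action` in which the operators act on a direct sum of submodules. It
fixes the additive group structure of the direct sum, which unification does not find when `V` is a
type of functions. -/
theorem exists_ringC_action_directSum {V : Type*} [AddCommGroup V] [Module k V] {Γ : Type*}
    [DecidableEq Γ] (P : Γ → Submodule k V) (X : ℤ → Module.End k (⨁ γ, P γ))
    (hcomm : ∀ i j, X i * X j = X j * X i)
    (hrel : ∀ i j, X i * X i + algebraMap k (Module.End k (⨁ γ, P γ)) i
      = X j * X j + algebraMap k (Module.End k (⨁ γ, P γ)) j) :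
    ∃ ρ : RingC k →ₐ[k] (Module.End k (⨁ γ, P γ))ᵐᵒᵖ, ∀ i, ρ (genC k i) = op (X i) :=
  exists_ringC_action X hcomm hrel

end Actions

/-! ### Separating labels -/

section Separating

/-- The labels of the steps between the degrees `0` and `n`, where the step between `n` and `n + 1`
carries the label `-n`. -/
noncomputable def steps (n : ℤ) : Finset ℤ := Finset.Ioc (min 0 (-n)) (max 0 (-n))

/-- The labels that separate the object `I` of `ℤ_fin` from the degree `n`. -/
noncomputable def sep (I : ZFin) (n : ℤ) : Finset ℤ := ofBoolRing I ∆ steps n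

theorem ofBoolRing_add_zfin (I J : ZFin) : ofBoolRing (I + J) = ofBoolRing I ∆ ofBoolRing J := rfl

theorem ofBoolRing_degC (j : ℤ) : ofBoolRing (degC j) = {j} := rfl

theorem mem_sep_add_degC {I : ZFin} {i j n : ℤ} :
    i ∈ sep (I + degC j) n ↔ (i ∈ sep I n ↔ i ≠ j) := by
  simp only [sep, ofBoolRing_add_zfin, ofBoolRing_degC, Finset.mem_symmDiff, Finset.mem_singleton]
  tauto

theorem mem_steps_succ {i n : ℤ} : i ∈ steps (n + 1) ↔ (i ∈ steps n ↔ i ≠ -n) := by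
  simp only [steps, Finset.mem_Ioc]
  omega

theorem mem_sep_succ {I : ZFin} {i n : ℤ} :
    i ∈ sep I (n + 1) ↔ (i ∈ sep I n ↔ i ≠ -n) := by
  have h := mem_steps_succ (i := i) (n := n)
  simp only [sep, Finset.mem_symmDiff]
  tauto

theorem toBoolRing_steps_succ (n : ℤ) :
    (toBoolRing (steps (n + 1)) : ZFin) = toBoolRing (steps n) + degC (-n) := by
  apply ofBoolRing.injective
  ext i
  have h := mem_steps_succ (i := i) (n := n)
  simp only [ofBoolRing_toBoolRing, ofBoolRing_add_zfin, ofBoolRing_degC, Finset.mem_symmDiff,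
    Finset.mem_singleton]
  tauto

theorem add_degC_add_degC (I : ZFin) (i : ℤ) : I + degC i + degC i = I := by
  rw [add_assoc, degC_add_self, add_zero]

theorem add_toBoolRing_sep (I : ZFin) (n : ℤ) :
    I + toBoolRing (sep I n) = toBoolRing (steps n) := by
  apply ofBoolRing.injective
  simp [sep, ofBoolRing_add_zfin]

theorem neg_mem_sep_steps {n p : ℤ} : -p ∈ sep (toBoolRing (steps n)) p ↔ p < n := by
  simp only [sep, ofBoolRing_toBoolRing, Finset.mem_symmDiff, steps, Finset.mem_Ioc]
  omega

theorem eq_toBoolRing_steps {I : ZFin} {n : ℤ} (h : sep I n = ∅) : I = toBoolRing (steps n) := by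
  have h' : ofBoolRing I = steps n := symmDiff_eq_bot.1 h
  rw [← h', toBoolRing_ofBoolRing]

theorem sep_add_degC_of_mem {I : ZFin} {i n : ℤ} (h : i ∈ sep I n) :
    sep (I + degC i) n = (sep I n).erase i := by
  ext j
  rw [mem_sep_add_degC, Finset.mem_erase]
  by_cases hj : j = i
  · subst hj; simp [h]
  · simp [hj]

theorem sep_add_degC_of_notMem {I : ZFin} {i n : ℤ} (h : i ∉ sep I n) :
    sep (I + degC i) n = insert i (sep I n) := by
  ext j
  rw [mem_sep_add_degC, Finset.mem_insert]
  by_cases hj : j = i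
  · subst hj; simp [h]
  · simp [hj]

theorem neg_mem_sep_iff {I : ZFin} {p q : ℤ} (h : p ≤ q) : -q ∈ sep I p ↔ -q ∈ sep I q := by
  have : -q ∈ steps p ↔ -q ∈ steps q := by
    simp only [steps, Finset.mem_Ioc]
    omega
  simp only [sep, Finset.mem_symmDiff, this]

theorem neg_mem_sep_iff_succ {I : ZFin} {p q : ℤ} (h : q < p) :
    -q ∈ sep I p ↔ -q ∈ sep I (q + 1) := by
  have : -q ∈ steps p ↔ -q ∈ steps (q + 1) := by
    simp only [steps, Finset.mem_Ioc]
    omega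
  simp only [sep, Finset.mem_symmDiff, this]

theorem sep_succ_of_notMem {I : ZFin} {n : ℤ} (h : -n ∉ sep I n) :
    sep I (n + 1) = insert (-n) (sep I n) := by
  ext i
  rw [mem_sep_succ, Finset.mem_insert]
  by_cases hi : i = -n
  · subst hi; simp [h]
  · simp [hi]

theorem sep_succ_of_mem {I : ZFin} {n : ℤ} (h : -n ∈ sep I n) :
    sep I (n + 1) = (sep I n).erase (-n) := by
  ext i
  rw [mem_sep_succ, Finset.mem_erase]
  by_cases hi : i = -n
  · subst hi; simp [h]
  · simp [hi]

/-- In degrees far on either side of `0` the separating labels lie on different sides of `0`, apart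
from those of `I`, each of which separates `I` from only one of the two degrees. -/
theorem exists_disjoint_sep (I : ZFin) : ∃ p q, Disjoint (sep I p) (sep I q) := by
  obtain ⟨B, hB⟩ : ∃ B : ℕ, ∀ i ∈ ofBoolRing I, i.natAbs < B :=
    ⟨(ofBoolRing I).sup Int.natAbs + 1, fun i hi =>
      Nat.lt_succ_of_le (Finset.le_sup (f := Int.natAbs) hi)⟩
  -- `steps (-B)` is `(0, B]` and `steps B` is `(-B, 0]`.
  refine ⟨-B, B, Finset.disjoint_left.2 fun i hp hq => ?_⟩
  simp only [sep, Finset.mem_symmDiff, steps, Finset.mem_Ioc] at hp hq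
  by_cases hi : i ∈ ofBoolRing I
  · have := hB i hi
    simp only [hi, true_and, not_true, and_false, or_false] at hp hq
    omega
  · simp only [hi, false_and, not_false_eq_true, and_true, false_or] at hp hq
    omega

end Separating

/-! ### Identities in the Weyl algebra -/

section WeylIdentities

variable (k : Type u) [Field k]

/-- The element `xy - (n + i)` of the Weyl algebra. In degree `n` it acts as the square of the
generator `x_i` of `C`. -/
noncomputable def weylSq (i n : ℤ) : WeylAlgebra k :=
  weylGen k WeylGen.x * weylGen k WeylGen.y - ((n + i : ℤ) : WeylAlgebra k)

theorem x_mul_weylSq (i n : ℤ) :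
    weylGen k WeylGen.x * weylSq k i (n + 1) = weylSq k i n * weylGen k WeylGen.x := by
  have h := weylGen_comm k
  have hc := Int.cast_commute (n + i) (weylGen k WeylGen.x)
  have h2 : weylGen k WeylGen.x * (weylGen k WeylGen.x * weylGen k WeylGen.y)
      = weylGen k WeylGen.x * weylGen k WeylGen.y * weylGen k WeylGen.x + weylGen k WeylGen.x := by
    rw [h, mul_add, mul_one, ← mul_assoc, h]
  simp only [weylSq, mul_sub, sub_mul, h2, hc.eq]
  push_cast
  noncomm_ring

theorem y_mul_weylSq (i n : ℤ) :
    weylGen k WeylGen.y * weylSq k i n = weylSq k i (n + 1) * weylGen k WeylGen.y := by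
  have h := weylGen_comm k
  have hc := Int.cast_commute (n + i) (weylGen k WeylGen.y)
  have h2 : weylGen k WeylGen.y * (weylGen k WeylGen.x * weylGen k WeylGen.y)
      = weylGen k WeylGen.x * weylGen k WeylGen.y * weylGen k WeylGen.y - weylGen k WeylGen.y := by
    rw [← mul_assoc, eq_sub_of_add_eq h.symm, sub_mul, one_mul]
  have e : ((n + 1 + i : ℤ) : WeylAlgebra k) = ((n + i : ℤ) : WeylAlgebra k) + 1 := by
    push_cast
    abel
  simp only [weylSq, mul_sub, sub_mul, h2, e, hc.eq, add_mul, one_mul]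
  abel

theorem weylSq_neg_self (n : ℤ) :
    weylSq k (-n) n = weylGen k WeylGen.x * weylGen k WeylGen.y := by
  simp [weylSq]

theorem weylSq_neg_succ (n : ℤ) :
    weylSq k (-n) (n + 1) = weylGen k WeylGen.y * weylGen k WeylGen.x := by
  simp [weylSq, weylGen_comm]

theorem weylSq_add (i j n : ℤ) : weylSq k i n + (i : WeylAlgebra k) = weylSq k j n + j := by
  simp only [weylSq]
  push_cast
  abel

theorem weylSq_commute (i j n : ℤ) : weylSq k i n * weylSq k j n = weylSq k j n * weylSq k i n := by
  have h : weylSq k i n = weylSq k j n + ((j - i : ℤ) : WeylAlgebra k) := by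
    rw [eq_sub_of_add_eq (weylSq_add k i j n)]
    push_cast
    abel
  rw [h, add_mul, mul_add, (Int.cast_commute (j - i) (weylSq k j n)).eq]

theorem x_mem : weylGen k WeylGen.x ∈ weylGrading k 1 :=
  gen_mem_wordGrading k (weylGen k) weylDeg WeylGen.x

theorem y_mem : weylGen k WeylGen.y ∈ weylGrading k (-1) :=
  gen_mem_wordGrading k (weylGen k) weylDeg WeylGen.y

theorem weylSq_mem (i n : ℤ) : weylSq k i n ∈ weylGrading k 0 := by
  refine sub_mem ?_ ?_
  · simpa using SetLike.mul_mem_graded (x_mem k) (y_mem k)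
  · rw [← zsmul_one]
    exact zsmul_mem (SetLike.GradedOne.one_mem (A := weylGrading k)) _

end WeylIdentities

/-! ### The functor from graded modules over the Weyl algebra -/

section Functor

variable {k : Type u} [Field k]

namespace GrMod

section

variable {M : GrMod.{w} (weylGrading k)}

theorem smul_x_mem {n : ℤ} {m : M.carrier} (hm : m ∈ M.component n) :
    m <• weylGen k WeylGen.x ∈ M.component (n + 1) :=
  M.op_smul_mem hm (x_mem k)

theorem smul_y_mem {n : ℤ} {m : M.carrier} (hm : m ∈ M.component (n + 1)) :
    m <• weylGen k WeylGen.y ∈ M.component n := by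
  simpa using M.op_smul_mem hm (y_mem k)

theorem smul_weylSq_mem {n : ℤ} {m : M.carrier} (i l : ℤ) (hm : m ∈ M.component n) :
    m <• weylSq k i l ∈ M.component n := by
  simpa using M.op_smul_mem hm (weylSq_mem k i l)

variable (M)

/-- The families `(t n)` of homogeneous elements, one in each degree `n`, in which `t n` and
`t (n + 1)` determine each other along the step with label `-n`: through `x` if this label does not
separate `I` from `n`, through `y` if it does. It plays the role of the value at `I` of the right
Kan extension of `M`. -/
def compatible (I : ZFin) : Submodule k (ℤ → M.carrier) where
  carrier := {t | (∀ n, t n ∈ M.component n) ∧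
    (∀ n, -n ∉ sep I n → t (n + 1) = t n <• weylGen k WeylGen.x) ∧
    ∀ n, -n ∈ sep I n → t n = t (n + 1) <• weylGen k WeylGen.y}
  zero_mem' := ⟨fun n => zero_mem _, fun n _ => (smul_zero _).symm, fun n _ => (smul_zero _).symm⟩
  add_mem' := by
    rintro s t ⟨hs, hs1, hs2⟩ ⟨ht, ht1, ht2⟩
    refine ⟨fun n => add_mem (hs n) (ht n), fun n h => ?_, fun n h => ?_⟩
    · simp only [Pi.add_apply, hs1 n h, ht1 n h, smul_add]
    · rw [Pi.add_apply, Pi.add_apply, hs2 n h, ht2 n h, smul_add]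
  smul_mem' := by
    rintro c t ⟨ht, ht1, ht2⟩
    refine ⟨fun n => base_smul_mem c (ht n), fun n h => ?_, fun n h => ?_⟩
    · rw [Pi.smul_apply, Pi.smul_apply, ht1 n h, smul_comm]
    · rw [Pi.smul_apply, Pi.smul_apply, ht2 n h, smul_comm]

variable {M}

/-- The action of `x_i` on a family of elements: multiplication by `weylSq i n` in the degrees
that `i` does not separate from `I`. -/
noncomputable def crossing (I : ZFin) (i : ℤ) (t : ℤ → M.carrier) (n : ℤ) : M.carrier :=
  if i ∈ sep I n then t n else t n <• weylSq k i n

theorem crossing_mem {I : ZFin} (i : ℤ) {t : ℤ → M.carrier} (ht : t ∈ M.compatible I) :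
    crossing I i t ∈ M.compatible (I + degC i) := by
  obtain ⟨h0, hx, hy⟩ := ht
  -- On the step with label `i` itself the two conditions trade places, because `weylSq` is `xy` at
  -- its lower end and `yx` at its upper end; on the other steps `weylSq` commutes past `x` and `y`.
  refine ⟨fun n => ?_, fun n hn => ?_, fun n hn => ?_⟩
  · unfold crossing
    split_ifs
    · exact h0 n
    · exact smul_weylSq_mem i n (h0 n)
  · rw [mem_sep_add_degC] at hn
    unfold crossing
    simp only [mem_sep_succ]
    by_cases hi : i = -n
    · subst hi
      have hn' : -n ∈ sep I n := by tauto
      simp only [hn', ne_eq, not_true, iff_false, if_true, if_false]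
      rw [hy n hn', weylSq_neg_succ, op_smul_mul]
    · have hn' : -n ∉ sep I n := by tauto
      by_cases h : i ∈ sep I n
      · simp [h, hi, hx n hn']
      · simp only [h, hi, ne_eq, not_false_eq_true, iff_true, if_false]
        rw [hx n hn', op_smul_op_smul, op_smul_op_smul, x_mul_weylSq]
  · rw [mem_sep_add_degC] at hn
    unfold crossing
    simp only [mem_sep_succ]
    by_cases hi : i = -n
    · subst hi
      have hn' : -n ∉ sep I n := by tauto
      simp only [hn', ne_eq, not_true, if_true, if_false]
      rw [hx n hn', weylSq_neg_self, op_smul_mul]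
    · have hn' : -n ∈ sep I n := by tauto
      by_cases h : i ∈ sep I n
      · simp only [h, hi, ne_eq, not_false_eq_true, if_true]
        exact hy n hn'
      · simp only [h, hi, ne_eq, not_false_eq_true, iff_true, if_false]
        rw [hy n hn', op_smul_op_smul, op_smul_op_smul, y_mul_weylSq]

/-- The component `(I, I + {i})` of the action of `x_i`. -/
noncomputable def crossingMap (M : GrMod.{w} (weylGrading k)) (i : ℤ) (I : ZFin) :
    M.compatible I →ₗ[k] M.compatible (I + degC i) where
  toFun t := ⟨crossing I i t, crossing_mem i t.2⟩
  map_add' s t := by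
    ext n
    simp only [crossing, Submodule.coe_add, Pi.add_apply]
    split_ifs <;> simp
  map_smul' c t := by
    ext n
    simp only [crossing, Submodule.coe_smul, Pi.smul_apply, RingHom.id_apply]
    split_ifs
    · rfl
    · rw [smul_comm]

theorem crossing_crossing_comm (I : ZFin) (i j : ℤ) (t : ℤ → M.carrier) :
    crossing (I + degC j) i (crossing I j t) = crossing (I + degC i) j (crossing I i t) := by
  rcases eq_or_ne i j with rfl | hij
  · rfl
  ext n
  simp only [crossing, mem_sep_add_degC, hij, hij.symm, ne_eq, not_false_eq_true, iff_true]
  split_ifs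
  · rfl
  · rfl
  · rfl
  · rw [op_smul_op_smul, op_smul_op_smul, weylSq_commute]

theorem crossing_crossing_self (I : ZFin) (i : ℤ) (t : ℤ → M.carrier) (n : ℤ) :
    crossing (I + degC i) i (crossing I i t) n = t n <• weylSq k i n := by
  simp only [crossing, mem_sep_add_degC, ne_eq, not_true, iff_false]
  by_cases h : i ∈ sep I n <;> simp [h]

variable (M)

theorem shiftEnd_crossingMap_comm (i j : ℤ) :
    shiftEnd (M.crossingMap i) * shiftEnd (M.crossingMap j)
      = shiftEnd (M.crossingMap j) * shiftEnd (M.crossingMap i) := by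
  refine DirectSum.linearMap_ext _ fun I => LinearMap.ext fun t => ?_
  simp only [LinearMap.comp_apply, Module.End.mul_apply, DirectSum.lof_eq_of, shiftEnd_of]
  exact of_eq_of (add_right_comm _ _ _) (crossing_crossing_comm I i j (t : ℤ → M.carrier))

theorem shiftEnd_crossingMap_rel (i j : ℤ) :
    shiftEnd (M.crossingMap i) * shiftEnd (M.crossingMap i)
        + algebraMap k (Module.End k (⨁ I, M.compatible I)) i
      = shiftEnd (M.crossingMap j) * shiftEnd (M.crossingMap j)
        + algebraMap k (Module.End k (⨁ I, M.compatible I)) j := by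
  refine DirectSum.linearMap_ext _ fun I => LinearMap.ext fun t => ?_
  have key : ∀ i : ℤ, ∃ t' : M.compatible I,
      (∀ n, (t' : ℤ → M.carrier) n = (t : ℤ → M.carrier) n <• (weylSq k i n + (i : WeylAlgebra k))) ∧
      (shiftEnd (M.crossingMap i) * shiftEnd (M.crossingMap i)
          + algebraMap k (Module.End k (⨁ I, M.compatible I)) i)
        (DirectSum.of (fun I => M.compatible I) I t) = DirectSum.of (fun I => M.compatible I) I t' := by
    intro i
    have hmem : ∀ n, crossing (I + degC i) i (crossing I i t) n
        = (t : ℤ → M.carrier) n <• weylSq k i n := crossing_crossing_self I i (t : ℤ → M.carrier)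
    let s : M.compatible I := ⟨crossing (I + degC i) i (crossing I i t), by
      simpa only [add_degC_add_degC] using crossing_mem i (crossing_mem i t.2)⟩
    refine ⟨s + (i : k) • t, fun n => ?_, ?_⟩
    · simp only [Submodule.coe_add, Submodule.coe_smul_of_tower, Pi.add_apply, Pi.smul_apply]
      rw [MulOpposite.op_add, add_smul, base_smul_def, map_intCast]
      exact congrArg (· + _) (hmem n)
    · rw [LinearMap.add_apply, Module.End.mul_apply, shiftEnd_of, shiftEnd_of, map_add,
        Module.algebraMap_end_apply]
      exact congrArg₂ (· + ·) (of_eq_of (add_degC_add_degC I i) rfl)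
        ((DirectSum.lof k _ (fun I => M.compatible I) I).map_smul (i : k) t).symm
  obtain ⟨s, hs, hs'⟩ := key i
  obtain ⟨s', hs1, hs1'⟩ := key j
  simp only [LinearMap.comp_apply, DirectSum.lof_eq_of]
  rw [hs', hs1']
  exact of_eq_of rfl (funext fun n => by rw [hs, hs1, weylSq_add k i j n])

/-- The action of `C` on `⨁ I, M.compatible I`. -/
noncomputable def kanAction :
    RingC k →ₐ[k] (Module.End k (⨁ I, M.compatible I))ᵐᵒᵖ :=
  (exists_ringC_action_directSum M.compatible _ M.shiftEnd_crossingMap_comm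
    M.shiftEnd_crossingMap_rel).choose

theorem kanAction_gen (i : ℤ) : M.kanAction (genC k i) = op (shiftEnd (M.crossingMap i)) :=
  (exists_ringC_action_directSum M.compatible _ M.shiftEnd_crossingMap_comm
    M.shiftEnd_crossingMap_rel).choose_spec i

/-- The graded `C`-module attached to a graded module over the Weyl algebra: its component of
degree `I` consists of the compatible families. -/
noncomputable def kan : GrMod.{w} (gradingC k) :=
  ofFamily (g := genC k) (d := degC) (𝒜 := gradingC k) rfl M.compatible M.kanAction
    M.crossingMap M.kanAction_gen

/-- A compatible family as a homogeneous element of `M.kan`. -/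
noncomputable def kanSingle (I : ZFin) : M.compatible I →+ M.kan.carrier :=
  single (g := genC k) (d := degC) (𝒜 := gradingC k) rfl M.compatible M.kanAction
    M.crossingMap M.kanAction_gen I

variable {M}

theorem kanSingle_mem (I : ZFin) (t : M.compatible I) : M.kanSingle I t ∈ M.kan.component I :=
  single_mem ..

theorem exists_kanSingle {I : ZFin} {s : M.kan.carrier} (hs : s ∈ M.kan.component I) :
    ∃ t, M.kanSingle I t = s :=
  exists_single _ _ _ _ _ hs

theorem kanSingle_injective (I : ZFin) : Function.Injective (M.kanSingle I) :=
  single_injective ..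

theorem kanSingle_smul_gen (i : ℤ) (I : ZFin) (t : M.compatible I) :
    M.kanSingle I t <• genC k i = M.kanSingle (I + degC i) (M.crossingMap i I t) :=
  single_smul_gen ..

theorem kanSingle_smul_algebraMap (c : k) (I : ZFin) (t : M.compatible I) :
    M.kanSingle I t <• algebraMap k (RingC k) c = M.kanSingle I (c • t) :=
  single_smul_algebraMap ..

end

section Map

variable {M N : GrMod.{w} (weylGrading k)}

/-- A morphism applied to every element of a compatible family. -/
def compatibleMap (f : M ⟶ N) (I : ZFin) : M.compatible I →+ N.compatible I where
  toFun t := ⟨fun n => f.1 ((t : ℤ → M.carrier) n), fun n => f.2 n _ (t.2.1 n),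
    fun n h => (congrArg f.1 (t.2.2.1 n h)).trans (map_smul f.1 _ _),
    fun n h => (congrArg f.1 (t.2.2.2 n h)).trans (map_smul f.1 _ _)⟩
  map_zero' := Subtype.ext (funext fun _ => map_zero f.1)
  map_add' _ _ := Subtype.ext (funext fun _ => map_add f.1 _ _)

/-- The component maps of a morphism act on all compatible families. -/
noncomputable def kanMapAdd (f : M ⟶ N) : M.kan.carrier →+ N.kan.carrier :=
  DirectSum.toAddMonoid fun I => (N.kanSingle I).comp (compatibleMap f I)

theorem kanMapAdd_single (f : M ⟶ N) (I : ZFin) (t : M.compatible I) :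
    kanMapAdd f (M.kanSingle I t) = N.kanSingle I (compatibleMap f I t) :=
  DirectSum.toAddMonoid_of (fun I => (N.kanSingle I).comp (compatibleMap f I)) I t

/-- The morphism of graded `C`-modules induced by a morphism of graded modules over the Weyl
algebra. -/
noncomputable def kanMap (f : M ⟶ N) : M.kan ⟶ N.kan :=
  homOfAddHom (genC_adjoin k) (kanMapAdd f)
    (fun I s hs => by
      obtain ⟨t, rfl⟩ := exists_kanSingle hs
      rw [kanMapAdd_single]
      exact kanSingle_mem _ _)
    (fun c I s hs => by
      obtain ⟨t, rfl⟩ := exists_kanSingle hs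
      rw [kanSingle_smul_algebraMap, kanMapAdd_single, kanMapAdd_single, kanSingle_smul_algebraMap]
      congr 1
      exact Subtype.ext (funext fun n => map_smul f.1 (op (algebraMap k (WeylAlgebra k) c)) _))
    (fun i I s hs => by
      obtain ⟨t, rfl⟩ := exists_kanSingle hs
      rw [kanSingle_smul_gen, kanMapAdd_single, kanMapAdd_single, kanSingle_smul_gen]
      congr 1
      refine Subtype.ext (funext fun n => ?_)
      simp only [compatibleMap, crossingMap, crossing, LinearMap.coe_mk, AddHom.coe_mk,
        AddMonoidHom.coe_mk, ZeroHom.coe_mk]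
      split_ifs
      · rfl
      · exact map_smul f.1 _ _)

theorem kanMap_single (f : M ⟶ N) (I : ZFin) (t : M.compatible I) :
    (kanMap f).1 (M.kanSingle I t) = N.kanSingle I (compatibleMap f I t) :=
  kanMapAdd_single f I t

theorem kan_hom_ext {N : GrMod.{w} (gradingC k)} {f g : M.kan ⟶ N}
    (h : ∀ I t, f.1 (M.kanSingle I t) = g.1 (M.kanSingle I t)) : f = g :=
  hom_ext fun I s hs => by
    obtain ⟨t, rfl⟩ := exists_kanSingle hs
    exact h I t

end Map

variable (k) in
/-- The functor `M ↦ M.kan` from `Gr(A, ℤ)` to `Gr(C, ℤ_fin)`. -/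
noncomputable def kanFunctor : GrMod.{w} (weylGrading k) ⥤ GrMod.{w} (gradingC k) where
  obj := kan
  map := kanMap
  map_id M := kan_hom_ext fun I t => kanMap_single _ I t
  map_comp {M N P} f g := kan_hom_ext fun I t => by
    refine (kanMap_single _ I t).trans ?_
    change _ = (kanMap g).1 ((kanMap f).1 (M.kanSingle I t))
    rw [kanMap_single, kanMap_single]
    rfl

instance : (kanFunctor.{u, w} k).Additive where
  map_add {M N f g} := kan_hom_ext fun I t => by
    change _ = (kanMap f).1 (M.kanSingle I t) + (kanMap g).1 (M.kanSingle I t)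
    rw [kanMap_single, kanMap_single, ← map_add]
    exact kanMap_single _ I t

instance : (kanFunctor.{u, w} k).Linear k where
  map_smul {M N} f c := kan_hom_ext fun I t => by
    change _ = (kanMap f).1 (M.kanSingle I t) <• algebraMap k (RingC k) c
    rw [kanMap_single, kanSingle_smul_algebraMap]
    exact kanMap_single _ I t

end GrMod

end Functor

/-! ### Full faithfulness -/

namespace GrMod

variable {k : Type u} [Field k] {M N : GrMod.{w} (weylGrading k)}

/-- The orbit of `m` under the powers of `x` (in degrees above `n`) and of `y` (below `n`). -/
noncomputable def orbit (n : ℤ) (m : M.carrier) (p : ℤ) : M.carrier :=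
  if n ≤ p then m <• weylGen k WeylGen.x ^ (p - n).toNat
  else m <• weylGen k WeylGen.y ^ (n - p).toNat

@[simp] theorem orbit_self (n : ℤ) (m : M.carrier) : orbit n m n = m := by
  simp [orbit]

theorem orbit_succ {n p : ℤ} (h : n ≤ p) (m : M.carrier) :
    orbit n m (p + 1) = orbit n m p <• weylGen k WeylGen.x := by
  rw [orbit, orbit, if_pos (by omega), if_pos h,
    show (p + 1 - n).toNat = (p - n).toNat + 1 by omega, pow_succ, op_smul_mul]

theorem orbit_pred {n p : ℤ} (h : p < n) (m : M.carrier) :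
    orbit n m p = orbit n m (p + 1) <• weylGen k WeylGen.y := by
  rw [orbit, if_neg (by omega), show (n - p).toNat = (n - (p + 1)).toNat + 1 by omega, pow_succ,
    op_smul_mul]
  rcases eq_or_lt_of_le (Int.add_one_le_iff.2 h) with rfl | h'
  · simp
  · rw [orbit, if_neg (by omega)]

theorem orbit_mem_component {n : ℤ} {m : M.carrier} (hm : m ∈ M.component n) (p : ℤ) :
    orbit n m p ∈ M.component p := by
  rcases le_total n p with h | h
  · induction p, h using Int.leInduction with
    | base => simpa using hm
    | succ p hp ih =>
      rw [orbit_succ hp]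
      exact smul_x_mem ih
  · induction p, h using Int.leInductionDown with
    | base => simpa using hm
    | pred p hp ih =>
      rw [orbit_pred (by omega)]
      refine smul_y_mem ?_
      simpa using ih

/-- The compatible family with value `m` in degree `n`, for the object of `ℤ_fin` that no label
separates from `n`. -/
noncomputable def orbitFamily (n : ℤ) :
    M.component n →+ M.compatible (toBoolRing (steps n)) where
  toFun m := ⟨orbit n m.1, orbit_mem_component m.2,
    fun _ h => orbit_succ (not_lt.1 (mt neg_mem_sep_steps.2 h)) _,
    fun _ h => orbit_pred (neg_mem_sep_steps.1 h) _⟩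
  map_zero' := Subtype.ext (funext fun p => by simp [orbit])
  map_add' a b := Subtype.ext (funext fun p => by
    simp only [orbit, AddSubgroup.coe_add, Submodule.coe_add, Pi.add_apply]
    split_ifs <;> rw [smul_add])

theorem orbitFamily_apply (n : ℤ) (m : M.component n) :
    (orbitFamily n m : ℤ → M.carrier) = orbit n m.1 := rfl

theorem orbitFamily_eval {n : ℤ} (t : M.compatible (toBoolRing (steps n))) :
    orbitFamily n ⟨(t : ℤ → M.carrier) n, t.2.1 n⟩ = t := by
  refine Subtype.ext (funext fun p => ?_)
  rw [orbitFamily_apply]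
  rcases le_total n p with h | h
  · induction p, h using Int.leInduction with
    | base => simp
    | succ p hp ih =>
      rw [orbit_succ hp, ih]
      exact (t.2.2.1 p (mt neg_mem_sep_steps.1 (not_lt.2 hp))).symm
  · induction p, h using Int.leInductionDown with
    | base => simp
    | pred p hp ih =>
      have h : p - 1 < n := by omega
      have h2 := t.2.2.2 (p - 1) (neg_mem_sep_steps.2 h)
      rw [sub_add_cancel] at h2
      rw [orbit_pred h, sub_add_cancel, ih, h2]

instance : (kanFunctor.{u, w} k).Faithful where
  map_injective {M N f g} h := hom_ext fun n m hm => by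
    have h1 := congrArg (fun φ : M.kan ⟶ N.kan =>
      φ.1 (M.kanSingle _ (orbitFamily n ⟨m, hm⟩))) h
    change (kanMap f).1 _ = (kanMap g).1 _ at h1
    rw [kanMap_single, kanMap_single] at h1
    have h2 := congrFun (congrArg Subtype.val (kanSingle_injective _ h1)) n
    change f.1 (orbit n m n) = g.1 (orbit n m n) at h2
    rwa [orbit_self] at h2

section Full

variable (h : M.kan ⟶ N.kan)

/-- The map on compatible families in degree `I` underlying a morphism `M.kan ⟶ N.kan`. -/
noncomputable def onFamilies (I : ZFin) : M.compatible I →+ N.compatible I :=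
  have hex : ∀ t, ∃ t', N.kanSingle I t' = h.1 (M.kanSingle I t) := fun t =>
    exists_kanSingle (h.2 I _ (kanSingle_mem I t))
  { toFun t := (hex t).choose
    map_zero' := kanSingle_injective I (by
      rw [(hex 0).choose_spec]
      simp only [map_zero])
    map_add' s t := kanSingle_injective I (by
      rw [(hex _).choose_spec, map_add, map_add, map_add, (hex s).choose_spec,
        (hex t).choose_spec]) }

theorem kanSingle_onFamilies (I : ZFin) (t : M.compatible I) :
    N.kanSingle I (onFamilies h I t) = h.1 (M.kanSingle I t) :=
  (exists_kanSingle (h.2 I _ (kanSingle_mem I t))).choose_spec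

theorem onFamilies_smul (c : k) (I : ZFin) (t : M.compatible I) :
    onFamilies h I (c • t) = c • onFamilies h I t :=
  kanSingle_injective I (by
    rw [kanSingle_onFamilies, ← kanSingle_smul_algebraMap, ← kanSingle_smul_algebraMap,
      kanSingle_onFamilies]
    exact map_smul h.1 _ _)

theorem onFamilies_crossingMap (i : ℤ) (I : ZFin) (t : M.compatible I) :
    onFamilies h (I + degC i) (M.crossingMap i I t) = N.crossingMap i I (onFamilies h I t) :=
  kanSingle_injective _ (by
    rw [kanSingle_onFamilies, ← kanSingle_smul_gen, ← kanSingle_smul_gen, kanSingle_onFamilies]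
    exact map_smul h.1 _ _)

/-- The map in degree `n` underlying a morphism `M.kan ⟶ N.kan`. -/
noncomputable def onComponent (n : ℤ) : M.component n →+ N.carrier :=
  ((Pi.evalAddMonoidHom _ n).comp
    (N.compatible (toBoolRing (steps n))).subtype.toAddMonoidHom).comp
      ((onFamilies h _).comp (orbitFamily n))

theorem onComponent_apply (n : ℤ) (m : M.component n) :
    onComponent h n m = (onFamilies h _ (orbitFamily n m) : ℤ → N.carrier) n := rfl

/-- A morphism `M.kan ⟶ N.kan` acts on families element by element. The value in degree `n` does
not change when the labels that separate `I` from `n` are crossed one after the other. -/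
theorem onFamilies_apply (I : ZFin) (t : M.compatible I) (n : ℤ) :
    (onFamilies h I t : ℤ → N.carrier) n
      = onComponent h n ⟨(t : ℤ → M.carrier) n, t.2.1 n⟩ := by
  induction hd : (sep I n).card using Nat.strong_induction_on generalizing I with | _ d ih =>
  rcases (sep I n).eq_empty_or_nonempty with hI | ⟨i, hi⟩
  · obtain rfl := eq_toBoolRing_steps hI
    rw [onComponent_apply, orbitFamily_eval]
  · have hlt : (sep (I + degC i) n).card < d := by
      rw [sep_add_degC_of_mem hi, ← hd]
      exact Finset.card_erase_lt_of_mem hi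
    have h1 := ih _ hlt _ (M.crossingMap i I t) rfl
    have hM : (M.crossingMap i I t : ℤ → M.carrier) n = (t : ℤ → M.carrier) n := if_pos hi
    have hN : (N.crossingMap i I (onFamilies h I t) : ℤ → N.carrier) n
        = (onFamilies h I t : ℤ → N.carrier) n := if_pos hi
    rw [onFamilies_crossingMap, hN] at h1
    rw [h1]
    exact congrArg _ (Subtype.ext hM)

/-- The morphism of graded modules over the Weyl algebra that induces `h`. -/
noncomputable def kanPreimage : M ⟶ N :=
  homOfAddHom (weylGen_adjoin k) (M.glue (onComponent h))
    (fun n m hm => by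
      rw [glue_apply _ _ hm]
      exact (onFamilies h _ _).2.1 n)
    (fun c n m hm => by
      have hc : m <• algebraMap k (WeylAlgebra k) c ∈ M.component n := base_smul_mem c hm
      rw [glue_apply _ _ hm, glue_apply _ _ hc, onComponent_apply, onComponent_apply]
      have e : orbitFamily n ⟨m <• algebraMap k (WeylAlgebra k) c, hc⟩
          = c • orbitFamily n ⟨m, hm⟩ := by
        rw [← orbitFamily_eval (c • orbitFamily n ⟨m, hm⟩)]
        congr 2
        change _ = c • orbit n m n
        rw [orbit_self, base_smul_def]
      rw [e, onFamilies_smul]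
      rfl)
    (fun i n m hm => by
      rw [glue_apply _ _ hm]
      cases i with
      | x =>
        have hn : -n ∉ sep (toBoolRing (steps n)) n := by simp [neg_mem_sep_steps]
        rw [glue_apply _ _ (smul_x_mem hm), onComponent_apply h n,
          ← (onFamilies h _ _).2.2.1 n hn, onFamilies_apply]
        congr 2
        rw [orbitFamily_apply, orbit_succ le_rfl, orbit_self]
      | y =>
        obtain ⟨p, rfl⟩ : ∃ p, n = p + 1 := ⟨n - 1, by omega⟩
        have hn : -p ∈ sep (toBoolRing (steps (p + 1))) p := by simp [neg_mem_sep_steps]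
        rw [glue_apply _ _ (smul_y_mem hm), onComponent_apply h (p + 1),
          ← (onFamilies h _ _).2.2.2 p hn, onFamilies_apply]
        congr 2
        rw [orbitFamily_apply, orbit_pred (by omega), orbit_self])

theorem kanPreimage_apply {n : ℤ} {m : M.carrier} (hm : m ∈ M.component n) :
    (kanPreimage h).1 m = onComponent h n ⟨m, hm⟩ :=
  glue_apply _ _ hm

theorem kanMap_kanPreimage : kanMap (kanPreimage h) = h :=
  kan_hom_ext fun I t => by
    rw [kanMap_single, ← kanSingle_onFamilies]
    congr 1
    refine Subtype.ext (funext fun n => ?_)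
    rw [onFamilies_apply]
    exact kanPreimage_apply h (t.2.1 n)

end Full

instance : (kanFunctor.{u, w} k).Full where
  map_surjective h := ⟨kanPreimage h, kanMap_kanPreimage h⟩

end GrMod

/-! ### Square-free monomials in `C` -/

section Monomials

theorem prod_mul_prod_eq_symmDiff {α R : Type*} [DecidableEq α] [CommMonoid R] (f : α → R)
    (A B : Finset α) :
    (∏ i ∈ A, f i) * ∏ i ∈ B, f i = (∏ i ∈ A ∆ B, f i) * (∏ i ∈ A ∩ B, f i) ^ 2 := by
  have hd : Disjoint (A \ B) (B \ A) := disjoint_sdiff_sdiff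
  have hA := Finset.prod_sdiff (f := f) (Finset.inter_subset_left (s₁ := A) (s₂ := B))
  have hB := Finset.prod_sdiff (f := f) (Finset.inter_subset_right (s₁ := A) (s₂ := B))
  rw [Finset.sdiff_inter_self_left] at hA
  rw [Finset.sdiff_inter_self_right] at hB
  have hS : A ∆ B = (A \ B) ∪ (B \ A) := rfl
  rw [hS, Finset.prod_union hd, ← hA, ← hB, pow_two]
  exact mul_mul_mul_comm _ _ _ _

variable (k : Type u) [Field k]

/-- The product of the generators of `C` with labels in `S`. -/
noncomputable def monomialC (S : Finset ℤ) : RingC k := ∏ i ∈ S, genC k i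

theorem monomialC_insert {S : Finset ℤ} {i : ℤ} (h : i ∉ S) :
    monomialC k (insert i S) = monomialC k S * genC k i := by
  rw [monomialC, Finset.prod_insert h, mul_comm, monomialC]

theorem genC_mul_monomialC_erase {S : Finset ℤ} {i : ℤ} (h : i ∈ S) :
    genC k i * monomialC k (S.erase i) = monomialC k S :=
  Finset.mul_prod_erase S (genC k) h

theorem genC_mem (i : ℤ) : genC k i ∈ gradingC k (degC i) :=
  gen_mem_wordGrading k (genC k) degC i

theorem monomialC_mem (S : Finset ℤ) : monomialC k S ∈ gradingC k (toBoolRing S) := by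
  induction S using Finset.induction_on with
  | empty => exact SetLike.GradedOne.one_mem (A := gradingC k)
  | insert i S hi ih =>
    have h := SetLike.mul_mem_graded (A := gradingC k) ih (genC_mem k i)
    rw [monomialC_insert k hi]
    convert h using 2
    apply ofBoolRing.injective
    rw [ofBoolRing_add_zfin, ofBoolRing_degC, ofBoolRing_toBoolRing, ofBoolRing_toBoolRing]
    ext j
    simp only [Finset.mem_insert, Finset.mem_symmDiff, Finset.mem_singleton]
    by_cases hj : j = i
    · subst hj; simp [hi]
    · simp [hj]

theorem genC_sq_sub (i j : ℤ) :
    genC k i * genC k i = genC k j * genC k j + ((j - i : ℤ) : RingC k) := by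
  rw [eq_sub_of_add_eq (genC_rel k i j)]
  push_cast
  ring

/-- In characteristic zero the squares of two distinct generators differ by a unit, so the squares
of monomials with disjoint supports generate the unit ideal of the degree-zero part. -/
theorem exists_bezout_monomialC [CharZero k] {A B : Finset ℤ} (h : Disjoint A B) :
    ∃ a ∈ gradingC k 0, ∃ b ∈ gradingC k 0,
      a * monomialC k A ^ 2 + b * monomialC k B ^ 2 = 1 := by
  have hsq : ∀ i, genC k i * genC k i ∈ gradingC k 0 := fun i => by
    have := SetLike.mul_mem_graded (A := gradingC k) (genC_mem k i) (genC_mem k i)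
    rwa [degC_add_self] at this
  let sq : ℤ → gradingC k 0 := fun i => ⟨genC k i * genC k i, hsq i⟩
  have hcop : IsCoprime (∏ i ∈ A, sq i) (∏ i ∈ B, sq i) := by
    refine IsCoprime.prod_left fun i hi => IsCoprime.prod_right fun j hj => ?_
    have hij : j - i ≠ 0 := fun e =>
      (Finset.disjoint_left.1 h hi) (by rwa [← sub_eq_zero.1 e])
    have hk : ((j - i : ℤ) : k) ≠ 0 := by exact_mod_cast hij
    have e : sq i = sq j + algebraMap k (gradingC k 0) ((j - i : ℤ) : k) := by
      refine Subtype.ext ?_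
      change genC k i * genC k i = genC k j * genC k j + algebraMap k (RingC k) ((j - i : ℤ) : k)
      rw [map_intCast]
      exact genC_sq_sub k i j
    refine ⟨algebraMap k _ ((j - i : ℤ) : k)⁻¹, -algebraMap k _ ((j - i : ℤ) : k)⁻¹, ?_⟩
    rw [e, mul_add, ← map_mul, inv_mul_cancel₀ hk, map_one]
    ring
  have hprod : ∀ S : Finset ℤ, ((∏ i ∈ S, sq i : gradingC k 0) : RingC k) = monomialC k S ^ 2 := by
    intro S
    have := map_prod (SetLike.GradeZero.subring (gradingC k)).subtype sq S
    refine this.trans ?_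
    rw [monomialC, pow_two, ← Finset.prod_mul_distrib]
    rfl
  obtain ⟨a, b, hab⟩ := hcop
  refine ⟨a, a.2, b, b.2, ?_⟩
  rw [← hprod, ← hprod]
  exact congrArg Subtype.val hab

end Monomials

namespace GrMod

variable {k : Type u} [Field k]

/-! ### Reconstructing an element from its multiples -/

section Reconstruction

variable {N : GrMod.{w} (gradingC k)}

theorem smul_monomialC_mem {I : ZFin} {m : N.carrier} (hm : m ∈ N.component I) (n : ℤ) :
    m <• monomialC k (sep I n) ∈ N.component (toBoolRing (steps n)) := by
  have h := N.op_smul_mem hm (monomialC_mem k (sep I n))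
  rwa [add_toBoolRing_sep] at h

variable {I : ZFin} {τ : ℤ → N.carrier}

/-- The values of a compatible family in degrees `p` and `q`, compared along the steps between `p`
and `q`. -/
theorem compare_values
    (h1 : ∀ n, -n ∉ sep I n → τ (n + 1) = τ n <• genC k (-n))
    (h2 : ∀ n, -n ∈ sep I n → τ n = τ (n + 1) <• genC k (-n)) (p q : ℤ) :
    τ p <• monomialC k (sep I p ∆ sep I q) = τ q <• monomialC k (sep I p \ sep I q) ^ 2 := by
  rcases le_total p q with h | h
  · induction q, h using Int.leInduction with
    | base => simp [monomialC]
    | succ q hq ih =>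
      have hpq := neg_mem_sep_iff (I := I) hq
      have hA : sep I p ∆ sep I (q + 1) = insert (-q) (sep I p ∆ sep I q) := by
        ext i
        simp only [Finset.mem_insert, Finset.mem_symmDiff, mem_sep_succ]
        by_cases hi : i = -q
        · subst hi; simp [hpq, em]
        · simp [hi]
      have hA' : -q ∉ sep I p ∆ sep I q := by
        simp [Finset.mem_symmDiff, hpq]
      rw [hA, monomialC_insert k hA', op_smul_mul, ih]
      by_cases hn : -q ∈ sep I q
      · have hB : sep I p \ sep I (q + 1) = insert (-q) (sep I p \ sep I q) := by
          ext i
          simp only [Finset.mem_insert, Finset.mem_sdiff, mem_sep_succ]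
          by_cases hi : i = -q
          · subst hi; simp [hpq, hn]
          · simp [hi]
        have hB' : -q ∉ sep I p \ sep I q := by simp [hn]
        rw [hB, monomialC_insert k hB', h2 q hn, op_smul_op_smul, op_smul_op_smul]
        congr 2
        ring
      · have hB : sep I p \ sep I (q + 1) = sep I p \ sep I q := by
          ext i
          simp only [Finset.mem_sdiff, mem_sep_succ]
          by_cases hi : i = -q
          · subst hi; simp [hpq, hn]
          · simp [hi]
        rw [hB, h1 q hn, op_smul_op_smul, op_smul_op_smul, mul_comm]
  · induction q, h using Int.leInductionDown with
    | base => simp [monomialC]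
    | pred q' hq ih =>
      obtain ⟨q, rfl⟩ : ∃ q, q' = q + 1 := ⟨q' - 1, by omega⟩
      rw [add_sub_cancel_right]
      have hpq := neg_mem_sep_iff_succ (I := I) (show q < p by omega)
      have hs : -q ∈ sep I (q + 1) ↔ -q ∉ sep I q := by simp [mem_sep_succ]
      have hA : sep I p ∆ sep I q = insert (-q) (sep I p ∆ sep I (q + 1)) := by
        ext i
        simp only [Finset.mem_insert, Finset.mem_symmDiff, mem_sep_succ (n := q)]
        by_cases hi : i = -q
        · subst hi; simp [hpq, hs, em']
        · simp [hi]
      have hA' : -q ∉ sep I p ∆ sep I (q + 1) := by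
        simp [Finset.mem_symmDiff, hpq]
      rw [hA, monomialC_insert k hA', op_smul_mul, ih]
      by_cases hn : -q ∈ sep I q
      · have hB : sep I p \ sep I (q + 1) = sep I p \ sep I q := by
          ext i
          simp only [Finset.mem_sdiff, mem_sep_succ (n := q)]
          by_cases hi : i = -q
          · subst hi; simp [hpq, hs, hn]
          · simp [hi]
        rw [hB, h2 q hn, op_smul_op_smul, op_smul_op_smul, mul_comm]
      · have hB : sep I p \ sep I q = insert (-q) (sep I p \ sep I (q + 1)) := by
          ext i
          simp only [Finset.mem_insert, Finset.mem_sdiff, mem_sep_succ (n := q)]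
          by_cases hi : i = -q
          · subst hi; simp [hpq, hs, hn]
          · simp [hi]
        have hB' : -q ∉ sep I p \ sep I (q + 1) := by simp [hs, hn]
        rw [hB, monomialC_insert k hB', h1 q hn, op_smul_op_smul, op_smul_op_smul]
        congr 2
        ring

/-- The relation of `compare_values` multiplied by the square of the monomial of
`sep I p ∩ sep I q`, which makes both coefficients expressions in the monomials of `sep I p` and
`sep I q`. -/
theorem compare_multiples
    (h1 : ∀ n, -n ∉ sep I n → τ (n + 1) = τ n <• genC k (-n))
    (h2 : ∀ n, -n ∈ sep I n → τ n = τ (n + 1) <• genC k (-n)) (p q : ℤ) :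
    τ p <• (monomialC k (sep I p) * monomialC k (sep I q))
      = τ q <• monomialC k (sep I p) ^ 2 := by
  have e1 : monomialC k (sep I p) * monomialC k (sep I q)
      = monomialC k (sep I p ∆ sep I q) * monomialC k (sep I p ∩ sep I q) ^ 2 :=
    prod_mul_prod_eq_symmDiff _ _ _
  have e2 : monomialC k (sep I p)
      = monomialC k (sep I p \ sep I q) * monomialC k (sep I p ∩ sep I q) := by
    have h := Finset.prod_sdiff (f := genC k)
      (Finset.inter_subset_left (s₁ := sep I p) (s₂ := sep I q))
    rw [Finset.sdiff_inter_self_left] at h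
    exact h.symm
  rw [e1, op_smul_mul, compare_values h1 h2, op_smul_op_smul, e2, mul_pow]

/-- An element of degree `I` is determined by its multiples by the monomials of all the sets
`sep I n`, because two of these sets are disjoint. -/
theorem eq_zero_of_smul_monomialC [CharZero k] (I : ZFin) {m : N.carrier}
    (hm : ∀ n, m <• monomialC k (sep I n) = 0) : m = 0 := by
  obtain ⟨p, q, hpq⟩ := exists_disjoint_sep I
  obtain ⟨a, -, b, -, hab⟩ := exists_bezout_monomialC k hpq
  have h : m = m <• (monomialC k (sep I p) * (monomialC k (sep I p) * a)
      + monomialC k (sep I q) * (monomialC k (sep I q) * b)) := by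
    rw [show monomialC k (sep I p) * (monomialC k (sep I p) * a)
      + monomialC k (sep I q) * (monomialC k (sep I q) * b) = 1 by rw [← hab]; ring]
    simp
  rw [h, MulOpposite.op_add, add_smul, op_smul_mul, op_smul_mul m (monomialC k (sep I q)), hm, hm,
    smul_zero, smul_zero, add_zero]

/-- Every family that satisfies the compatibility conditions is the family of multiples of some
element of degree `I`. -/
theorem exists_smul_monomialC_eq [CharZero k]
    (h0 : ∀ n, τ n ∈ N.component (toBoolRing (steps n)))
    (h1 : ∀ n, -n ∉ sep I n → τ (n + 1) = τ n <• genC k (-n))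
    (h2 : ∀ n, -n ∈ sep I n → τ n = τ (n + 1) <• genC k (-n)) :
    ∃ m ∈ N.component I, ∀ n, m <• monomialC k (sep I n) = τ n := by
  obtain ⟨p, q, hpq⟩ := exists_disjoint_sep I
  obtain ⟨a, ha, b, hb, hab⟩ := exists_bezout_monomialC k hpq
  have hmem : ∀ n, ∀ c ∈ gradingC k 0, τ n <• (monomialC k (sep I n) * c) ∈ N.component I := by
    intro n c hc
    have h := N.op_smul_mem (N.op_smul_mem (h0 n) (monomialC_mem k (sep I n))) hc
    rw [add_zero, ← add_toBoolRing_sep I n, add_assoc, ← two_nsmul] at h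
    have h3 : (2 : ℕ) • (toBoolRing (sep I n) : ZFin) = 0 := by
      rw [two_nsmul]
      exact symmDiff_self (sep I n)
    rw [h3, add_zero] at h
    rwa [op_smul_mul]
  -- The element is `τ p * x_{sep I p} * a + τ q * x_{sep I q} * b`, where `x_S` is the monomial of
  -- `S` and `a`, `b` are the Bézout coefficients.
  refine ⟨_, add_mem (hmem p a ha) (hmem q b hb), fun n => ?_⟩
  have key : ∀ r c, (τ r <• (monomialC k (sep I r) * c)) <• monomialC k (sep I n)
      = τ n <• (monomialC k (sep I r) ^ 2 * c) := by
    intro r c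
    rw [op_smul_op_smul, mul_right_comm, op_smul_mul, compare_multiples h1 h2, op_smul_op_smul]
  rw [smul_add, key, key, ← add_smul, ← MulOpposite.op_add, mul_comm, mul_comm _ b, hab]
  simp

end Reconstruction

/-! ### Essential surjectivity -/

section EssSurj

variable (N : GrMod.{w} (gradingC k))

/-- A homogeneous component of a graded module as a `k`-subspace. -/
noncomputable def componentSubmodule (I : ZFin) : Submodule k N.carrier :=
  { N.component I with smul_mem' := fun c _ hm => base_smul_mem c hm }

/-- Multiplication by a homogeneous element of `C`, between components of a graded module. -/
noncomputable def mulMap {I J : ZFin} (c : RingC k)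
    (h : ∀ m ∈ N.component I, m <• c ∈ N.component J) :
    N.componentSubmodule I →ₗ[k] N.componentSubmodule J where
  toFun m := ⟨m.1 <• c, h m.1 m.2⟩
  map_add' _ _ := Subtype.ext (smul_add _ _ _)
  map_smul' _ _ := Subtype.ext (smul_comm _ _ _)

/-- The component in degree `n` of the graded module over the Weyl algebra attached to `N`. -/
noncomputable abbrev restrictComponent (n : ℤ) : Submodule k N.carrier :=
  N.componentSubmodule (toBoolRing (steps n))

variable {N} in
theorem smul_genC_mem_succ {n : ℤ} {m : N.carrier}
    (hm : m ∈ N.component (toBoolRing (steps n))) :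
    m <• genC k (-n) ∈ N.component (toBoolRing (steps (n + 1))) := by
  rw [toBoolRing_steps_succ]
  exact N.op_smul_mem hm (genC_mem k _)

variable {N} in
theorem smul_genC_mem_pred {n : ℤ} {m : N.carrier}
    (hm : m ∈ N.component (toBoolRing (steps (n + 1)))) :
    m <• genC k (-n) ∈ N.component (toBoolRing (steps n)) := by
  have h := N.op_smul_mem hm (genC_mem k (-n))
  rwa [toBoolRing_steps_succ, add_degC_add_degC] at h

/-- Both `x`, from degree `n` to `n + 1`, and `y`, back from degree `n + 1` to `n`, act on the
restriction of `N` as multiplication by the generator `x_{-n}` of `C`. -/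
noncomputable def restrictGen :
    ∀ (i : WeylGen) (n : ℤ), N.restrictComponent n →ₗ[k] N.restrictComponent (n + weylDeg i)
  | WeylGen.x, n => N.mulMap (genC k (-n)) fun _ hm => smul_genC_mem_succ hm
  | WeylGen.y, n => N.mulMap (genC k (-(n + -1))) fun _ hm =>
      smul_genC_mem_pred (n := n + -1) (by rwa [neg_add_cancel_right])

theorem restrictGen_x_coe (n : ℤ) (m : N.restrictComponent n) :
    (N.restrictGen WeylGen.x n m : N.carrier) = m.1 <• genC k (-n) := rfl

theorem restrictGen_y_coe (n : ℤ) (m : N.restrictComponent n) :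
    (N.restrictGen WeylGen.y n m : N.carrier) = m.1 <• genC k (-(n + -1)) := rfl

theorem shiftEnd_restrictGen_rel :
    shiftEnd (N.restrictGen WeylGen.y) * shiftEnd (N.restrictGen WeylGen.x)
      = shiftEnd (N.restrictGen WeylGen.x) * shiftEnd (N.restrictGen WeylGen.y) + 1 := by
  refine DirectSum.linearMap_ext _ fun n => LinearMap.ext fun m => ?_
  have hmem : ∀ i : ℤ, m.1 <• (genC k i * genC k i) ∈ N.restrictComponent n := fun i => by
    have h := N.op_smul_mem (N.op_smul_mem m.2 (genC_mem k i)) (genC_mem k i)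
    rw [add_degC_add_degC] at h
    rwa [op_smul_mul]
  have hyx : DirectSum.of (fun n => N.restrictComponent n) _
        (N.restrictGen WeylGen.y _ (N.restrictGen WeylGen.x n m))
      = DirectSum.of (fun n => N.restrictComponent n) n ⟨_, hmem (-n)⟩ :=
    of_eq_of (by simp [weylDeg]) (by
      rw [restrictGen_y_coe, restrictGen_x_coe, op_smul_op_smul]
      simp [weylDeg])
  have hxy : DirectSum.of (fun n => N.restrictComponent n) _
        (N.restrictGen WeylGen.x _ (N.restrictGen WeylGen.y n m))
      = DirectSum.of (fun n => N.restrictComponent n) n ⟨_, hmem (-(n + -1))⟩ :=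
    of_eq_of (by simp [weylDeg]) (by
      rw [restrictGen_x_coe, restrictGen_y_coe, op_smul_op_smul]
      rfl)
  simp only [LinearMap.comp_apply, LinearMap.add_apply, Module.End.mul_apply,
    Module.End.one_apply, DirectSum.lof_eq_of, shiftEnd_of]
  rw [hyx, hxy, ← map_add]
  refine of_eq_of rfl ?_
  change m.1 <• _ = m.1 <• _ + m.1
  rw [genC_sq_sub k (-n) (-(n + -1)), MulOpposite.op_add, add_smul]
  simp

/-- The action of the Weyl algebra on the restriction of `N`. -/
noncomputable def restrictAction :
    WeylAlgebra k →ₐ[k] (Module.End k (⨁ n, N.restrictComponent n))ᵐᵒᵖ :=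
  weylAction _ _ N.shiftEnd_restrictGen_rel

theorem restrictAction_gen (i : WeylGen) :
    N.restrictAction (weylGen k i) = op (shiftEnd (N.restrictGen i)) := by
  rw [restrictAction, weylAction_gen]
  cases i <;> rfl

/-- The graded module over the Weyl algebra attached to a graded `C`-module `N`: its component in
degree `n` is the component of `N` at the object that no label separates from `n`. -/
noncomputable def restrict : GrMod.{w} (weylGrading k) :=
  ofFamily (𝒜 := weylGrading k) (g := weylGen k) (d := weylDeg) rfl N.restrictComponent
    N.restrictAction N.restrictGen N.restrictAction_gen

/-- A homogeneous element of `N.restrict`. -/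
noncomputable def restrictSingle (n : ℤ) : N.restrictComponent n →+ N.restrict.carrier :=
  single (𝒜 := weylGrading k) (g := weylGen k) (d := weylDeg) rfl N.restrictComponent
    N.restrictAction N.restrictGen N.restrictAction_gen n

variable {N}

theorem restrictSingle_mem (n : ℤ) (m : N.restrictComponent n) :
    N.restrictSingle n m ∈ N.restrict.component n :=
  single_mem ..

theorem exists_restrictSingle {n : ℤ} {s : N.restrict.carrier}
    (hs : s ∈ N.restrict.component n) : ∃ m, N.restrictSingle n m = s :=
  exists_single _ _ _ _ _ hs

theorem restrictSingle_injective (n : ℤ) : Function.Injective (N.restrictSingle n) :=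
  single_injective ..

theorem restrictSingle_congr {n p : ℤ} (h : n = p) {m : N.restrictComponent n}
    {m' : N.restrictComponent p} (hm : m.1 = m'.1) :
    N.restrictSingle n m = N.restrictSingle p m' :=
  single_eq_single _ _ _ _ _ h hm

theorem restrictSingle_smul_gen (i : WeylGen) (n : ℤ) (m : N.restrictComponent n) :
    N.restrictSingle n m <• weylGen k i
      = N.restrictSingle (n + weylDeg i) (N.restrictGen i n m) :=
  single_smul_gen ..

theorem restrictSingle_smul_x (n : ℤ) (m : N.restrictComponent n) :
    N.restrictSingle n m <• weylGen k WeylGen.x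
      = N.restrictSingle (n + 1) ⟨m.1 <• genC k (-n), smul_genC_mem_succ m.2⟩ :=
  restrictSingle_smul_gen ..

theorem restrictSingle_smul_y (n : ℤ) (m : N.restrictComponent (n + 1)) :
    N.restrictSingle (n + 1) m <• weylGen k WeylGen.y
      = N.restrictSingle n ⟨m.1 <• genC k (-n), smul_genC_mem_pred m.2⟩ := by
  rw [restrictSingle_smul_gen]
  refine restrictSingle_congr (by simp [weylDeg]) ?_
  rw [restrictGen_y_coe, add_neg_cancel_right]

theorem restrictSingle_smul_algebraMap (c : k) (n : ℤ) (m : N.restrictComponent n) :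
    N.restrictSingle n m <• algebraMap k (WeylAlgebra k) c = N.restrictSingle n (c • m) :=
  single_smul_algebraMap ..

theorem restrictSingle_smul_weylSq (i n : ℤ) (m m' : N.restrictComponent n)
    (hm : m'.1 = m.1 <• (genC k i * genC k i)) :
    N.restrictSingle n m <• weylSq k i n = N.restrictSingle n m' := by
  rw [weylSq, sub_eq_add_neg, MulOpposite.op_add, add_smul, op_smul_mul, restrictSingle_smul_x,
    restrictSingle_smul_y, ← Int.cast_neg, ← map_intCast (algebraMap k (WeylAlgebra k)),
    restrictSingle_smul_algebraMap, ← map_add]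
  refine restrictSingle_congr rfl ?_
  rw [hm, genC_sq_sub k i (-n)]
  change (m.1 <• genC k (-n)) <• genC k (-n) + m.1 <• algebraMap k (RingC k) _ = _
  rw [op_smul_op_smul, ← add_smul, ← MulOpposite.op_add, map_intCast]
  congr 3
  push_cast
  ring

variable (N)

/-- The element `m` of degree `I` as the family of its multiples by the monomials of the sets
`sep I n`. -/
noncomputable def toFamily (I : ZFin) : N.component I →+ N.restrict.compatible I where
  toFun m := ⟨fun n => N.restrictSingle n ⟨m.1 <• monomialC k (sep I n), smul_monomialC_mem m.2 n⟩,
    fun n => restrictSingle_mem n _,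
    fun n hn => by
      rw [restrictSingle_smul_x]
      refine restrictSingle_congr rfl ?_
      change m.1 <• monomialC k (sep I (n + 1)) = (m.1 <• monomialC k (sep I n)) <• genC k (-n)
      rw [sep_succ_of_notMem hn, monomialC_insert k hn, op_smul_mul],
    fun n hn => by
      rw [restrictSingle_smul_y]
      refine restrictSingle_congr rfl ?_
      change m.1 <• monomialC k (sep I n) = (m.1 <• monomialC k (sep I (n + 1))) <• genC k (-n)
      rw [sep_succ_of_mem hn, op_smul_op_smul, mul_comm, genC_mul_monomialC_erase k hn]⟩
  map_zero' := Subtype.ext (funext fun n => by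
    refine (restrictSingle_congr rfl ?_).trans (map_zero (N.restrictSingle n))
    exact smul_zero _)
  map_add' a b := Subtype.ext (funext fun n => by
    refine (restrictSingle_congr rfl ?_).trans (map_add (N.restrictSingle n) _ _)
    exact smul_add _ _ _)

variable {N}

theorem toFamily_apply (I : ZFin) (m : N.component I) (n : ℤ) :
    (N.toFamily I m : ℤ → N.restrict.carrier) n
      = N.restrictSingle n ⟨m.1 <• monomialC k (sep I n), smul_monomialC_mem m.2 n⟩ := rfl

theorem toFamily_smul_gen (i : ℤ) (I : ZFin) (m : N.component I) :
    N.toFamily (I + degC i) ⟨m.1 <• genC k i, N.op_smul_mem m.2 (genC_mem k i)⟩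
      = N.restrict.crossingMap i I (N.toFamily I m) := by
  refine Subtype.ext (funext fun n => ?_)
  change _ = crossing I i (N.toFamily I m : ℤ → N.restrict.carrier) n
  rw [crossing, toFamily_apply, toFamily_apply]
  split_ifs with hi
  · refine restrictSingle_congr rfl ?_
    change (m.1 <• genC k i) <• monomialC k (sep (I + degC i) n) = m.1 <• monomialC k (sep I n)
    rw [sep_add_degC_of_mem hi, op_smul_op_smul, genC_mul_monomialC_erase k hi]
  · refine (restrictSingle_smul_weylSq i n _ _ ?_).symm
    change (m.1 <• genC k i) <• monomialC k (sep (I + degC i) n)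
      = (m.1 <• monomialC k (sep I n)) <• (genC k i * genC k i)
    rw [sep_add_degC_of_notMem hi, monomialC_insert k hi, op_smul_op_smul, op_smul_op_smul]
    congr 2
    ring

theorem toFamily_smul_algebraMap (c : k) (I : ZFin) (m : N.component I)
    (hm : m.1 <• algebraMap k (RingC k) c ∈ N.component I) :
    N.toFamily I ⟨m.1 <• algebraMap k (RingC k) c, hm⟩ = c • N.toFamily I m := by
  refine Subtype.ext (funext fun n => ?_)
  change _ = (N.toFamily I m : ℤ → N.restrict.carrier) n <• algebraMap k (WeylAlgebra k) c
  rw [toFamily_apply, toFamily_apply, restrictSingle_smul_algebraMap]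
  refine restrictSingle_congr rfl ?_
  change (m.1 <• algebraMap k (RingC k) c) <• monomialC k (sep I n)
    = (m.1 <• monomialC k (sep I n)) <• algebraMap k (RingC k) c
  rw [op_smul_op_smul, op_smul_op_smul, mul_comm]

theorem toFamily_bijective [CharZero k] (I : ZFin) : Function.Bijective (N.toFamily I) := by
  constructor
  · refine (injective_iff_map_eq_zero _).2 fun m hm => Subtype.ext ?_
    refine eq_zero_of_smul_monomialC I fun n => ?_
    have h : N.restrictSingle n ⟨m.1 <• monomialC k (sep I n), smul_monomialC_mem m.2 n⟩ = 0 :=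
      congrFun (congrArg Subtype.val hm) n
    exact congrArg Subtype.val
      (restrictSingle_injective n (h.trans (map_zero (N.restrictSingle n)).symm))
  · intro t
    choose τ hτ using fun n => exists_restrictSingle (t.2.1 n)
    obtain ⟨m, hm, hmτ⟩ := exists_smul_monomialC_eq (I := I) (τ := fun n => (τ n).1)
      (fun n => (τ n).2)
      (fun n hn => by
        have h := t.2.2.1 n hn
        rw [← hτ, ← hτ, restrictSingle_smul_x] at h
        exact congrArg Subtype.val (restrictSingle_injective _ h))
      (fun n hn => by
        have h := t.2.2.2 n hn
        rw [← hτ, ← hτ, restrictSingle_smul_y] at h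
        exact congrArg Subtype.val (restrictSingle_injective _ h))
    refine ⟨⟨m, hm⟩, Subtype.ext (funext fun n => ?_)⟩
    rw [toFamily_apply, ← hτ]
    exact restrictSingle_congr rfl (hmτ n)

variable (N)

/-- The comparison morphism from `N` to the graded `C`-module rebuilt from its restriction. -/
noncomputable def toKanRestrict : N ⟶ N.restrict.kan :=
  homOfAddHom (genC_adjoin k) (N.glue fun I => (N.restrict.kanSingle I).comp (N.toFamily I))
    (fun I m hm => by
      rw [glue_apply _ _ hm]
      exact kanSingle_mem _ _)
    (fun c I m hm => by
      have hc : m <• algebraMap k (RingC k) c ∈ N.component I := base_smul_mem c hm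
      rw [glue_apply _ _ hm, glue_apply _ _ hc, AddMonoidHom.comp_apply, AddMonoidHom.comp_apply,
        kanSingle_smul_algebraMap, ← toFamily_smul_algebraMap c I ⟨m, hm⟩ hc])
    (fun i I m hm => by
      rw [glue_apply _ _ hm, glue_apply _ _ (N.op_smul_mem hm (genC_mem k i)),
        AddMonoidHom.comp_apply, AddMonoidHom.comp_apply, kanSingle_smul_gen,
        ← toFamily_smul_gen i I ⟨m, hm⟩])

theorem toKanRestrict_apply {I : ZFin} {m : N.carrier} (hm : m ∈ N.component I) :
    (N.toKanRestrict).1 m = N.restrict.kanSingle I (N.toFamily I ⟨m, hm⟩) :=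
  glue_apply _ _ hm

theorem bijOn_toKanRestrict [CharZero k] (I : ZFin) :
    Set.BijOn N.toKanRestrict.1 (N.component I) (N.restrict.kan.component I) := by
  refine ⟨fun m hm => N.toKanRestrict.2 I m hm, fun a ha b hb hab => ?_, fun s hs => ?_⟩
  · rw [toKanRestrict_apply N ha, toKanRestrict_apply N hb] at hab
    exact congrArg Subtype.val ((toFamily_bijective I).1 (kanSingle_injective I hab))
  · obtain ⟨t, rfl⟩ := exists_kanSingle hs
    obtain ⟨m, rfl⟩ := (toFamily_bijective I).2 t
    exact ⟨m.1, m.2, toKanRestrict_apply N m.2⟩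

instance [CharZero k] : (kanFunctor.{u, w} k).EssSurj where
  mem_essImage N :=
    let ⟨e⟩ := nonempty_iso_of_bijOn N.toKanRestrict N.bijOn_toKanRestrict
    ⟨N.restrict, ⟨e.symm⟩⟩

instance [CharZero k] : (kanFunctor.{u, w} k).IsEquivalence where

end EssSurj

end GrMod

end QuotientStackWeyl

theorem theorem5 (k : Type u) [Field k] [CharZero k] :
    ∃ e : QuotientStackWeyl.GrMod.{max u v} (QuotientStackWeyl.weylGrading k) ≌
        QuotientStackWeyl.GrMod.{max u v} (QuotientStackWeyl.gradingC k),
      e.functor.Additive ∧ e.functor.Linear k := by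
  refine ⟨(QuotientStackWeyl.GrMod.kanFunctor.{u, max u v} k).asEquivalence, ?_, ?_⟩
  · exact inferInstanceAs (QuotientStackWeyl.GrMod.kanFunctor k).Additive
  · exact inferInstanceAs ((QuotientStackWeyl.GrMod.kanFunctor k).Linear k)
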